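/- Let $(\Gamma,d)$ be a countable metric space. For $X\subset\Gamma$ and $r\ge 0$ put $X(r)=\{y\in\Gamma: d(y,x)\le r\text{ for some }x\in X\}$, and let $\mathcal P_0(\Gamma)$ be the set of finite subsets of $\Gamma$. To each $x\in\Gamma$ associate a finite-dimensional complex Hilbert space $\mathcal H_x$, and for $\Lambda\in\mathcal P_0(\Gamma)$ let $\mathcal A_\Lambda=\mathcal B\big(\bigotimes_{x\in\Lambda}\mathcal H_x\big)$ with the operator norm; for $\Lambda_0\subset\Lambda$, $\mathcal A_{\Lambda_0}$ is identified with $\mathcal A_{\Lambda_0}\otimes 1\subset\mathcal A_\Lambda$, and a linear map $\Phi$ on $\mathcal A_{\Lambda_0}$ acts on $\mathcal A_\Lambda$ as $\Phi\otimes\mathrm{id}$. Let $\|\Phi\|_{cb}=\sup_n\|\Phi\otimes\mathrm{id}_{M_n(\mathbb C)}\|$. Let $F:[0,\infty)\to(0,\infty)$ be an $F$-function on $(\Gamma,d)$: $F$ is non-increasing, $\sup_{x}\sum_{y}F(d(x,y))<\infty$, and for some $C>0$ $$\sum_{z\in\Gamma}F(d(x,z))F(d(z,y))\le C\,F(d(x,y))\qquad\text{for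 all }x,y\in\Gamma;$$ let $C_F$ be the infimum of all such $C$. Put $G(r)=\sup_{x\in\Gamma}\sum_{y:\,d(x,y)>r}F(d(x,y))$, and for $s\ge0$, $k>0$ put $\mathscr E_s(k)=\sum_{n\ge\lceil k\rceil}s^n/n!$. Let $\mathscr L=\{L_Z\}_{Z\in\mathcal P_0(\Gamma)}$ be a dissipative interaction: each $L_Z:\mathcal A_Z\to\mathcal A_Z$ has the Lindblad form $$L_Z(A)=i[H,A]+\sum_{j=1}^{\ell}\Big(K_j^*AK_j-\tfrac12\{K_j^*K_j,A\}\Big)$$ with $H=H^*$ and $K_1,\dots,K_\ell$ in $\mathcal A_Z$ (depending on $Z$). Let $\|\mathscr L\|_F$ be the infimum of all $M\ge0$ such that $\sum_{Z\ni x,y}\|L_Z\|_{cb}\le M\,F(d(x,y))$ for all $x,y\in\Gamma$, and assume $\|\mathscr L\|_F<\infty$. For $\Lambda\in\mathcal P_0(\Gamma)$, $t\ge0$ and $R>0$ let $$T^\Lambda_t=\exp\Big(t\sum_{Z\subset\Lambda}L_Z\Big),\qquad T^{\Lambda,R}_t=\exp\Big(t\sum_{Z\subset\Lambda,\ \mathrm{diam}(Z)\le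 R}L_Z\Big)$$ as maps on $\mathcal A_\Lambda$, and let $v=\|\mathscr L\|_F\,C_F$. Then for all finite $X\subset\Lambda\subset\Gamma$, all $A\in\mathcal A_X$ and all $t\ge0$, $r\ge0$, $R>0$, the set $X(r)$ is finite and $$\|T^\Lambda_t(A)-T^{\Lambda,R}_t(A)\|\le\|A\|\,\|\mathscr L\|_F\,G(R/2)\left(t\,|X(r)|+\frac{\mathscr E_{vt}(1+r/R)}{v\,C_F}\sum_{x\in X}\ \sum_{y\in\Lambda\setminus X(r)}F(d(x,y))\right),$$ where the right-hand side is read as $0$ if $\|\mathscr L\|_F=0$ or $\Gamma=\emptyset$. -/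

import Mathlib

open scoped ENNReal Matrix Nat Matrix.Norms.L2Operator

noncomputable section

namespace OpenSpin

/-! ### Finite volumes, observables

The spin at `x` has state space `ℂ^(ι x)`, with `ι x` an arbitrary finite type labelling an
orthonormal basis. The product configurations over `Λ` label an orthonormal basis of the tensor
product over `Λ`, and the observables are the operators on it, with their operator norm. -/

section Observables

variable {Γ : Type*} [DecidableEq Γ] (ι : Γ → Type*) [∀ x, Fintype (ι x)] [∀ x, DecidableEq (ι x)]

/-- Labels of the product orthonormal basis of the Hilbert space of the finite volume `Λ`. -/
abbrev Config (Λ : Finset Γ) : Type _ := ∀ x : Λ, ι x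

/-- The algebra of observables of the finite volume `Λ`: all operators on the tensor product of
the one-site spaces. Its norm is the operator norm for the Hilbert space norm. -/
abbrev Obs (Λ : Finset Γ) : Type _ := Matrix (Config ι Λ) (Config ι Λ) ℂ

variable {ι}

/-- Restriction of a configuration to a smaller volume. -/
def restrict {Z Λ : Finset Γ} (h : Z ⊆ Λ) (σ : Config ι Λ) : Config ι Z :=
  fun x => σ ⟨x, h x.2⟩

/-- The configuration equal to `a` on `Z` and to `σ` on `Λ \ Z`. -/
def glue {Z Λ : Finset Γ} (a : Config ι Z) (σ : Config ι Λ) : Config ι Λ :=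
  fun x => if hx : (x : Γ) ∈ Z then a ⟨x, hx⟩ else σ x

/-- The embedding `A ↦ A ⊗ 1` of the observables of `X` into those of `Λ ⊇ X`. -/
def embed {X Λ : Finset Γ} (h : X ⊆ Λ) (A : Obs ι X) : Obs ι Λ :=
  Matrix.of fun σ τ =>
    if ∀ x : Λ, (x : Γ) ∉ X → σ x = τ x then A (restrict h σ) (restrict h τ) else 0

/-- The extension `Φ ⊗ id` to the observables of `Λ ⊇ Z` of a linear map `Φ` on the observables
of `Z`: for fixed configurations off `Z`, the map `Φ` is applied to the block indexed by the
configurations on `Z`. -/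
def extend {Z Λ : Finset Γ} (h : Z ⊆ Λ) (Φ : Obs ι Z →ₗ[ℂ] Obs ι Z) :
    Obs ι Λ →ₗ[ℂ] Obs ι Λ where
  toFun M := Matrix.of fun σ τ =>
    Φ (Matrix.of fun a b => M (glue a σ) (glue b τ)) (restrict h σ) (restrict h τ)
  map_add' M N := by
    ext σ τ
    exact congrFun (congrFun (Φ.map_add (Matrix.of fun a b => M (glue a σ) (glue b τ))
      (Matrix.of fun a b => N (glue a σ) (glue b τ))) _) _
  map_smul' c M := by
    ext σ τ
    exact congrFun (congrFun (Φ.map_smul c (Matrix.of fun a b => M (glue a σ) (glue b τ))) _) _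

end Observables

/-! ### Completely bounded norm and Lindblad form -/

section Maps

variable {I : Type*} [Fintype I] [DecidableEq I]

/-- The map on `n × n` block matrices that applies `Φ` to every block. -/
def amplify (n : ℕ) (Φ : Matrix I I ℂ →ₗ[ℂ] Matrix I I ℂ) :
    Matrix (Fin n × I) (Fin n × I) ℂ →ₗ[ℂ] Matrix (Fin n × I) (Fin n × I) ℂ where
  toFun M := Matrix.of fun p q =>
    Φ (Matrix.of fun a b => M (p.1, a) (q.1, b)) p.2 q.2
  map_add' M N := by
    ext p q
    exact congrFun (congrFun (Φ.map_add (Matrix.of fun a b => M (p.1, a) (q.1, b))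
      (Matrix.of fun a b => N (p.1, a) (q.1, b))) _) _
  map_smul' c M := by
    ext p q
    exact congrFun (congrFun (Φ.map_smul c (Matrix.of fun a b => M (p.1, a) (q.1, b))) _) _

/-- The completely bounded norm: the supremum over `n` of the operator norms of the `n`-th
amplifications. -/
def cbNorm (Φ : Matrix I I ℂ →ₗ[ℂ] Matrix I I ℂ) : ℝ≥0∞ :=
  ⨆ n : ℕ, ENNReal.ofReal ‖LinearMap.toContinuousLinearMap (amplify n Φ)‖

/-- `Φ` is a Lindblad generator (in the Heisenberg picture). -/
def IsLindblad (Φ : Matrix I I ℂ →ₗ[ℂ] Matrix I I ℂ) : Prop :=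
  ∃ H : Matrix I I ℂ, H.IsHermitian ∧ ∃ (l : ℕ) (K : Fin l → Matrix I I ℂ),
    ∀ A : Matrix I I ℂ, Φ A = Complex.I • (H * A - A * H) +
      ∑ j, ((K j)ᴴ * A * K j - (1 / 2 : ℂ) • ((K j)ᴴ * K j * A + A * ((K j)ᴴ * K j)))

end Maps

/-! ### Decay functions -/

section Decay

variable (Γ : Type*) [MetricSpace Γ]

/-- `C` is admissible in the convolution condition for `F`. -/
def ConvBound (F : ℝ → ℝ) (C : ℝ) : Prop :=
  ∀ x y : Γ, ∑' z : Γ, ENNReal.ofReal (F (dist x z) * F (dist z y)) ≤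
    ENNReal.ofReal (C * F (dist x y))

/-- `F` (only its values on `[0, ∞)` matter) is an `F`-function on `Γ`. -/
structure IsFFunction (F : ℝ → ℝ) : Prop where
  pos : ∀ r, 0 ≤ r → 0 < F r
  antitone : AntitoneOn F (Set.Ici 0)
  summable : (⨆ x : Γ, ∑' y : Γ, ENNReal.ofReal (F (dist x y))) < ∞
  conv : ∃ C : ℝ, 0 < C ∧ ConvBound Γ F C

/-- The convolution constant `C_F`. -/
def convConst (F : ℝ → ℝ) : ℝ := sInf {C : ℝ | 0 < C ∧ ConvBound Γ F C}

/-- The tail function `G(r) = sup_x ∑_{d(x,y) > r} F(d(x,y))`; for an `F`-function the supremum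
is finite, so that no information is lost by `toReal`. -/
def tail (F : ℝ → ℝ) (r : ℝ) : ℝ :=
  (⨆ x : Γ, ∑' y : {y : Γ // r < dist x y}, ENNReal.ofReal (F (dist x y))).toReal

end Decay

/-- The tail `∑_{n ≥ ⌈k⌉} t^n / n!` of the exponential series. -/
def expTail (t k : ℝ) : ℝ := ∑' n : ℕ, t ^ (⌈k⌉₊ + n) / ((⌈k⌉₊ + n)! : ℝ)

/-! ### Interactions and dynamics -/

section Dynamics

variable {Γ : Type*} [MetricSpace Γ] [DecidableEq Γ]
  {ι : Γ → Type*} [∀ x, Fintype (ι x)] [∀ x, DecidableEq (ι x)]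

/-- The closed `r`-inflation `X(r)` of `X`, as a subset of the whole of `Γ`. -/
def inflation (X : Finset Γ) (r : ℝ) : Set Γ := {y | ∃ x ∈ X, dist y x ≤ r}

instance (X : Finset Γ) (r : ℝ) : DecidablePred (· ∈ inflation X r) :=
  Classical.decPred _

/-- The `F`-norm of a family of maps: the least `M` such that
`∑_{Z ∋ x, y} ‖L_Z‖_cb ≤ M F(d(x,y))` for all `x, y`. -/
def fNorm (F : ℝ → ℝ) (L : ∀ Z : Finset Γ, Obs ι Z →ₗ[ℂ] Obs ι Z) : ℝ≥0∞ :=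
  sInf {M : ℝ≥0∞ | ∀ x y : Γ,
    ∑' Z : {Z : Finset Γ // x ∈ Z ∧ y ∈ Z}, cbNorm (L Z) ≤ M * ENNReal.ofReal (F (dist x y))}

/-- The finite-volume generator `∑_{Z ⊆ Λ} L_Z`. -/
def generator (L : ∀ Z : Finset Γ, Obs ι Z →ₗ[ℂ] Obs ι Z) (Λ : Finset Γ) :
    Obs ι Λ →ₗ[ℂ] Obs ι Λ :=
  ∑ Z : {Z : Finset Γ // Z ∈ Λ.powerset}, extend (Finset.mem_powerset.1 Z.2) (L Z)

/-- The finite-range generator `∑_{Z ⊆ Λ, diam Z ≤ R} L_Z`. -/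
def generatorRange (L : ∀ Z : Finset Γ, Obs ι Z →ₗ[ℂ] Obs ι Z) (Λ : Finset Γ) (R : ℝ) :
    Obs ι Λ →ₗ[ℂ] Obs ι Λ :=
  ∑ Z : {Z : Finset Γ // Z ∈ Λ.powerset} with Metric.diam (Z.1 : Set Γ) ≤ R,
    extend (Finset.mem_powerset.1 Z.2) (L Z)

/-- The semigroup `exp (t 𝓖)` generated by a linear map `𝓖` on the observables of `Λ`. -/
def semigroup {Λ : Finset Γ} (𝓖 : Obs ι Λ →ₗ[ℂ] Obs ι Λ) (t : ℝ) : Obs ι Λ →L[ℂ] Obs ι Λ :=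
  NormedSpace.exp ((t : ℂ) • LinearMap.toContinuousLinearMap 𝓖)

/-- The finite-volume dynamics. -/
def dynamics (L : ∀ Z : Finset Γ, Obs ι Z →ₗ[ℂ] Obs ι Z) (Λ : Finset Γ) (t : ℝ) :
    Obs ι Λ →L[ℂ] Obs ι Λ :=
  semigroup (generator L Λ) t

/-- The finite-range approximation, of range `R`, of the finite-volume dynamics. -/
def dynamicsRange (L : ∀ Z : Finset Γ, Obs ι Z →ₗ[ℂ] Obs ι Z) (Λ : Finset Γ) (R t : ℝ) :
    Obs ι Λ →L[ℂ] Obs ι Λ :=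
  semigroup (generatorRange L Λ R) t

end Dynamics

end OpenSpin

end

/-!
Let `D Z` be the extension of `L_Z` to the observables of `Λ`. It is dissipative, because its Euler
steps are Kraus maps up to second order, and dissipativity passes to sums and gives contractive
evolutions. By Duhamel's formula it suffices to bound `‖D Z (T s A)‖` for the large sets `Z`, where
`T` is the evolution of finite range. The derivative of `D Z (T s A)` has a dissipative part,
from the terms disjoint from `Z`, which commute with `D Z`; the remaining terms touch `Z`, and
iterating over them bounds `‖D Z (T s A)‖` by the exponential series of the hopping operator
`f ↦ fun y => ∑ W ∋ y, ‖L_W‖_cb * ∑ z ∈ W, f z`, applied to the indicator function of `X`. Outside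
`X(r)` only the powers `n ≥ r / R` contribute, since the `n`-th power has range `n * R`, and the
convolution condition bounds its kernel by `F`; integration in time turns the tail of order `r / R`
into one of order `1 + r / R`. The large sets meeting a given point carry total weight at most
`‖L‖_F * G (R / 2)`, as such a set has a point at distance greater than `R / 2`.
-/

namespace OpenSpin

section Dissipative

open Filter Topology

variable {E : Type*} [NormedAddCommGroup E] [NormedSpace ℝ E]

/-- Dissipativity of a vector field on a normed space: its Euler steps increase the norm by `o(ε)`
only. This is the infinitesimal form of generating a contraction semigroup; unlike the latter it
passes to sums directly. -/
def IsDissipative (D : E → E) : Prop :=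
  ∀ x, ∀ δ > 0, ∀ᶠ ε : ℝ in 𝓝[>] 0, ‖x + ε • D x‖ ≤ ‖x‖ + δ * ε

theorem IsDissipative.zero : IsDissipative (0 : E → E) := by
  intro x δ hδ
  filter_upwards [self_mem_nhdsWithin] with ε (hε : 0 < ε)
  simpa using (mul_pos hδ hε).le

theorem IsDissipative.add {D D' : E → E} (hD : IsDissipative D) (hD' : IsDissipative D') :
    IsDissipative (D + D') := by
  intro x δ hδ
  have double : Tendsto (fun ε : ℝ => 2 * ε) (𝓝[>] 0) (𝓝[>] 0) := by
    have h := ((continuous_const_mul (2 : ℝ)).tendsto' 0 0 (mul_zero 2)).inf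
      (tendsto_principal_principal.2 fun ε (hε : ε ∈ Set.Ioi 0) =>
        Set.mem_Ioi.2 (mul_pos two_pos (Set.mem_Ioi.1 hε)))
    exact h
  filter_upwards [double.eventually (hD x (δ / 2) (half_pos hδ)),
    double.eventually (hD' x (δ / 2) (half_pos hδ))] with ε h h'
  calc ‖x + ε • (D x + D' x)‖
      = ‖(1 / 2 : ℝ) • (x + (2 * ε) • D x) + (1 / 2 : ℝ) • (x + (2 * ε) • D' x)‖ := by
        congr 1; module
    _ ≤ 1 / 2 * ‖x + (2 * ε) • D x‖ + 1 / 2 * ‖x + (2 * ε) • D' x‖ := by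
        refine (norm_add_le _ _).trans_eq ?_
        simp only [norm_smul, Real.norm_of_nonneg one_half_pos.le]
    _ ≤ ‖x‖ + δ * ε := by linarith

theorem IsDissipative.sum {α : Type*} {s : Finset α} {D : α → E → E}
    (hD : ∀ i ∈ s, IsDissipative (D i)) : IsDissipative (∑ i ∈ s, D i) :=
  Finset.sum_induction D IsDissipative (fun _ _ => IsDissipative.add) IsDissipative.zero hD

theorem IsDissipative.of_norm_add_smul_le {D : E → E} (c : ℝ)
    (h : ∀ ε : ℝ, 0 ≤ ε → ∀ x, ‖x + ε • D x‖ ≤ (1 + c * ε ^ 2) * ‖x‖) : IsDissipative D := by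
  intro x δ hδ
  have lim : Tendsto (fun ε : ℝ => c * ε * ‖x‖) (𝓝[>] 0) (𝓝 0) :=
    (Continuous.tendsto' (by fun_prop) 0 0 (by simp)).mono_left nhdsWithin_le_nhds
  filter_upwards [self_mem_nhdsWithin, lim.eventually_lt_const hδ] with ε (hε : 0 < ε) hlt
  calc ‖x + ε • D x‖ ≤ ‖x‖ + c * ε * ‖x‖ * ε := (h ε hε.le x).trans_eq (by ring)
    _ ≤ ‖x‖ + δ * ε := by gcongr

theorem IsDissipative.conj {E' : Type*} [NormedAddCommGroup E'] [NormedSpace ℝ E'] {D : E' → E'}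
    (hD : IsDissipative D) (e : E ≃ₗᵢ[ℝ] E') : IsDissipative fun x => e.symm (D (e x)) := by
  intro x δ hδ
  filter_upwards [hD (e x) δ hδ] with ε hε
  rw [e.norm_map] at hε
  rwa [← e.norm_map, map_add, map_smul, e.apply_symm_apply]

theorem IsDissipative.norm_le_of_hasDerivAt {D : E → E} (hD : IsDissipative D) {f g : ℝ → E}
    {B B' : ℝ → ℝ} {a b : ℝ} (hab : a ≤ b) (hf : ∀ s, HasDerivAt f (D (f s) + g s) s)
    (hB : ∀ s, HasDerivAt B (B' s) s) (ha : ‖f a‖ ≤ B a)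
    (hg : ∀ s ∈ Set.Ico a b, ‖g s‖ ≤ B' s) : ‖f b‖ ≤ B b := by
  refine image_le_of_liminf_slope_right_le_deriv_boundary
    (fun s _ => (hf s).continuousAt.norm.continuousWithinAt) ha
    (fun s _ => (hB s).continuousAt.continuousWithinAt) (fun s _ => (hB s).hasDerivWithinAt)
    (fun s hs r hr => Eventually.frequently ?_) (Set.right_mem_Icc.2 hab)
  obtain ⟨δ, hδ, hδr⟩ : ∃ δ > 0, B' s + δ + δ < r := ⟨(r - B' s) / 3, by linarith, by linarith⟩
  have shift : Tendsto (fun z => z - s) (𝓝[>] s) (𝓝[>] 0) := by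
    have h := ((continuous_sub_right s).tendsto' s 0 (sub_self s)).inf
      (tendsto_principal_principal.2 fun z (hz : z ∈ Set.Ioi s) =>
        Set.mem_Ioi.2 (sub_pos.2 (Set.mem_Ioi.1 hz)))
    exact h
  filter_upwards [self_mem_nhdsWithin, shift.eventually (hD (f s) δ hδ),
    ((hf s).isLittleO.def hδ).filter_mono nhdsWithin_le_nhds] with z (hz : s < z) euler remainder
  have hε : 0 < z - s := sub_pos.2 hz
  rw [Real.norm_of_nonneg hε.le] at remainder
  have bound : ‖f z‖ ≤ ‖f s‖ + (B' s + δ + δ) * (z - s) := calc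
    ‖f z‖ = ‖(f s + (z - s) • D (f s)) + (z - s) • g s +
          (f z - f s - (z - s) • (D (f s) + g s))‖ := by congr 1; module
    _ ≤ (‖f s‖ + δ * (z - s)) + (z - s) * B' s + δ * (z - s) := by
        refine norm_add₃_le.trans (add_le_add_three euler ?_ remainder)
        rw [norm_smul, Real.norm_of_nonneg hε.le]
        gcongr
        exact hg s hs
    _ = ‖f s‖ + (B' s + δ + δ) * (z - s) := by ring
  rw [slope_def_field, div_lt_iff₀ hε]
  calc ‖f z‖ - ‖f s‖ ≤ (B' s + δ + δ) * (z - s) := sub_le_iff_le_add'.2 bound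
    _ < r * (z - s) := by gcongr

end Dissipative

open scoped Kronecker

section Kraus

variable {I J : Type*} [Fintype I] [Fintype J]

theorem norm_one_kronecker_le [DecidableEq I] [DecidableEq J] (A : Matrix I I ℂ) :
    ‖(1 : Matrix J J ℂ) ⊗ₖ A‖ ≤ ‖A‖ := by
  let f : Matrix I I ℂ →⋆ₙₐ[ℂ] Matrix (J × I) (J × I) ℂ :=
    { toFun := fun A => (1 : Matrix J J ℂ) ⊗ₖ A
      map_smul' := fun c A => Matrix.kronecker_smul c _ A
      map_zero' := Matrix.kronecker_zero _
      map_add' := fun A B => Matrix.kronecker_add _ A B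
      map_mul' := fun A B => by rw [← Matrix.mul_kronecker_mul, one_mul]
      map_star' := fun A => by
        simp only [Matrix.star_eq_conjTranspose, Matrix.conjTranspose_kronecker,
          Matrix.conjTranspose_one] }
  exact NonUnitalStarAlgHom.norm_apply_le f A

theorem norm_submatrix_equiv [DecidableEq I] [DecidableEq J] (e : J ≃ I) (A : Matrix I I ℂ) :
    ‖A.submatrix e e‖ = ‖A‖ := by
  let f : Matrix I I ℂ →⋆ₙₐ[ℂ] Matrix J J ℂ :=
    { toFun := fun A => A.submatrix e e
      map_smul' := fun c A => rfl
      map_zero' := rfl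
      map_add' := fun A B => rfl
      map_mul' := fun A B => (Matrix.submatrix_mul_equiv A B e e e).symm
      map_star' := fun A => rfl }
  exact NonUnitalStarAlgHom.norm_map f (Matrix.reindex e.symm e.symm).injective A

theorem sum_conjTranspose_mul_mul_eq [DecidableEq J] (W : J → Matrix I I ℂ)
    (A : Matrix I I ℂ) :
    ∑ j, (W j)ᴴ * A * W j = (Matrix.of fun (p : J × I) b => W p.1 p.2 b)ᴴ *
      ((1 : Matrix J J ℂ) ⊗ₖ A) * Matrix.of fun (p : J × I) b => W p.1 p.2 b := by
  ext a b
  simp [Matrix.sum_apply, Matrix.mul_apply, Fintype.sum_prod_type, Matrix.one_apply]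

variable [DecidableEq I]

theorem norm_sum_conjTranspose_mul_mul_le (W : J → Matrix I I ℂ) (A : Matrix I I ℂ) :
    ‖∑ j, (W j)ᴴ * A * W j‖ ≤ ‖∑ j, (W j)ᴴ * W j‖ * ‖A‖ := by
  classical
  let V : Matrix (J × I) I ℂ := Matrix.of fun p b => W p.1 p.2 b
  have hone : ∑ j, (W j)ᴴ * W j = Vᴴ * V := by
    simpa using sum_conjTranspose_mul_mul_eq W 1
  rw [sum_conjTranspose_mul_mul_eq W A, hone, Matrix.l2_opNorm_conjTranspose_mul_self]
  calc ‖Vᴴ * ((1 : Matrix J J ℂ) ⊗ₖ A) * V‖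
      ≤ ‖Vᴴ‖ * ‖(1 : Matrix J J ℂ) ⊗ₖ A‖ * ‖V‖ :=
        (Matrix.l2_opNorm_mul _ _).trans (by gcongr; exact Matrix.l2_opNorm_mul _ _)
    _ ≤ ‖V‖ * ‖A‖ * ‖V‖ := by
        rw [Matrix.l2_opNorm_conjTranspose]
        gcongr
        exact norm_one_kronecker_le A
    _ = ‖V‖ * ‖V‖ * ‖A‖ := by ring

/-- The Kraus operators of an Euler step, up to second order in `ε`, for the generator
`A ↦ Gᴴ A + A G + ∑ j, (K j)ᴴ A (K j)`. -/
noncomputable def eulerKraus (ε : ℝ) (G : Matrix I I ℂ) (K : J → Matrix I I ℂ) :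
    Option J → Matrix I I ℂ
  | none => 1 + ε • G
  | some j => √ε • K j

theorem sum_eulerKraus {ε : ℝ} (hε : 0 ≤ ε) (G : Matrix I I ℂ) (K : J → Matrix I I ℂ)
    (A : Matrix I I ℂ) :
    ∑ o, (eulerKraus ε G K o)ᴴ * A * eulerKraus ε G K o =
      A + ε • (Gᴴ * A + A * G + ∑ j, (K j)ᴴ * A * K j) + ε ^ 2 • (Gᴴ * A * G) := by
  have jump (j : J) : (eulerKraus ε G K (some j))ᴴ * A * eulerKraus ε G K (some j) =
      ε • ((K j)ᴴ * A * K j) := by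
    rw [eulerKraus, Matrix.conjTranspose_smul, star_trivial, smul_mul_assoc, smul_mul_assoc,
      mul_smul_comm, smul_smul, Real.mul_self_sqrt hε]
  rw [Fintype.sum_option, Finset.sum_congr rfl fun j _ => jump j, ← Finset.smul_sum]
  simp only [eulerKraus, Matrix.conjTranspose_add,
    Matrix.conjTranspose_one, Matrix.conjTranspose_smul, star_trivial, add_mul, mul_add, one_mul,
    mul_one, smul_mul_assoc, mul_smul_comm]
  module

theorem norm_add_smul_lindblad_le {ε : ℝ} (hε : 0 ≤ ε) {G : Matrix I I ℂ}
    {K : J → Matrix I I ℂ} (hG : Gᴴ + G + ∑ j, (K j)ᴴ * K j = 0) (A : Matrix I I ℂ) :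
    ‖A + ε • (Gᴴ * A + A * G + ∑ j, (K j)ᴴ * A * K j)‖ ≤ (1 + 2 * ‖G‖ ^ 2 * ε ^ 2) * ‖A‖ := by
  have euler := sum_eulerKraus hε G K
  have kraus := norm_sum_conjTranspose_mul_mul_le (eulerKraus ε G K) A
  have norm_second_order : ‖ε ^ 2 • (Gᴴ * A * G)‖ ≤ ε ^ 2 * ‖G‖ ^ 2 * ‖A‖ := by
    rw [norm_smul, Real.norm_of_nonneg (sq_nonneg ε)]
    calc ε ^ 2 * ‖Gᴴ * A * G‖ ≤ ε ^ 2 * (‖Gᴴ‖ * ‖A‖ * ‖G‖) := by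
          gcongr; exact norm_mul₃_le
      _ = ε ^ 2 * ‖G‖ ^ 2 * ‖A‖ := by rw [Matrix.l2_opNorm_conjTranspose]; ring
  have norm_at_one : ‖∑ o, (eulerKraus ε G K o)ᴴ * eulerKraus ε G K o‖ ≤
      1 + ε ^ 2 * ‖G‖ ^ 2 := by
    have h := euler 1
    simp only [mul_one, one_mul, hG, smul_zero, add_zero] at h
    rw [h]
    refine (norm_add_le _ _).trans (add_le_add (IsStarProjection.one _).norm_le ?_)
    rw [norm_smul, Real.norm_of_nonneg (sq_nonneg ε), Matrix.l2_opNorm_conjTranspose_mul_self,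
      sq ‖G‖]
  calc ‖A + ε • (Gᴴ * A + A * G + ∑ j, (K j)ᴴ * A * K j)‖
      = ‖∑ o, (eulerKraus ε G K o)ᴴ * A * eulerKraus ε G K o - ε ^ 2 • (Gᴴ * A * G)‖ := by
        rw [euler, add_sub_cancel_right]
    _ ≤ (1 + ε ^ 2 * ‖G‖ ^ 2) * ‖A‖ + ε ^ 2 * ‖G‖ ^ 2 * ‖A‖ :=
        (norm_sub_le _ _).trans (add_le_add (kraus.trans (by gcongr)) norm_second_order)
    _ = (1 + 2 * ‖G‖ ^ 2 * ε ^ 2) * ‖A‖ := by ring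

end Kraus

section Generator

variable {I : Type*} [Fintype I] {Φ : Matrix I I ℂ →ₗ[ℂ] Matrix I I ℂ}

theorem IsLindblad.exists_eq_add_sum (h : IsLindblad Φ) :
    ∃ (G : Matrix I I ℂ) (l : ℕ) (K : Fin l → Matrix I I ℂ),
      Gᴴ + G + ∑ j, (K j)ᴴ * K j = 0 ∧
        ∀ A, Φ A = Gᴴ * A + A * G + ∑ j, (K j)ᴴ * A * K j := by
  obtain ⟨H, hH, l, K, hΦ⟩ := h
  set S : Matrix I I ℂ := ∑ j, (K j)ᴴ * K j with hS
  set G : Matrix I I ℂ := -Complex.I • H - (1 / 2 : ℂ) • S with hG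
  have hSstar : Sᴴ = S := by simp [hS, Matrix.conjTranspose_sum]
  have hGstar : Gᴴ = Complex.I • H - (1 / 2 : ℂ) • S := by
    rw [hG, Matrix.conjTranspose_sub, Matrix.conjTranspose_smul, Matrix.conjTranspose_smul,
      hSstar, hH.eq]
    simp
  refine ⟨G, l, K, ?_, fun A => ?_⟩
  · rw [hGstar, hG, ← hS]
    module
  · rw [hΦ, Finset.sum_sub_distrib, ← Finset.smul_sum, Finset.sum_add_distrib, ← Finset.sum_mul,
      ← Finset.mul_sum, ← hS, hGstar, hG]
    simp only [sub_mul, mul_sub, smul_mul_assoc, mul_smul_comm]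
    module

theorem IsLindblad.map_one [DecidableEq I] (h : IsLindblad Φ) : Φ 1 = 0 := by
  obtain ⟨G, l, K, hG, hΦ⟩ := h.exists_eq_add_sum
  simpa only [hΦ, mul_one, one_mul] using hG

theorem IsLindblad.isDissipative [DecidableEq I] (h : IsLindblad Φ) : IsDissipative Φ := by
  obtain ⟨G, l, K, hG, hΦ⟩ := h.exists_eq_add_sum
  refine IsDissipative.of_norm_add_smul_le (2 * ‖G‖ ^ 2) fun ε hε A => ?_
  rw [hΦ]
  exact norm_add_smul_lindblad_le hε hG A

theorem IsLindblad.amplify (h : IsLindblad Φ) (n : ℕ) : IsLindblad (amplify n Φ) := by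
  classical
  obtain ⟨H, hH, l, K, hΦ⟩ := h
  let e := Matrix.compAlgEquiv (Fin n) I ℂ ℂ
  have he (B : Matrix I I ℂ) : e.symm ((1 : Matrix (Fin n) (Fin n) ℂ) ⊗ₖ B) =
      Matrix.diagonal fun _ => B := by
    ext i j a b
    change ((1 : Matrix (Fin n) (Fin n) ℂ) ⊗ₖ B) (i, a) (j, b) = _
    obtain rfl | hij := eq_or_ne i j
    · simp
    · simp [hij]
  refine ⟨(1 : Matrix (Fin n) (Fin n) ℂ) ⊗ₖ H, ?_, l,
    fun j => (1 : Matrix (Fin n) (Fin n) ℂ) ⊗ₖ K j, fun M => e.symm.injective ?_⟩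
  · rw [Matrix.IsHermitian, Matrix.conjTranspose_kronecker, Matrix.conjTranspose_one, hH.eq]
  · have hamplify : e.symm (OpenSpin.amplify n Φ M) = (e.symm M).map Φ := rfl
    simp only [hamplify, Matrix.conjTranspose_kronecker, Matrix.conjTranspose_one, map_add, map_sub,
      map_smul, map_sum, map_mul, he]
    ext i j : 2
    simp [hΦ, Matrix.sum_apply, Matrix.diagonal_mul, Matrix.mul_diagonal]

theorem IsLindblad.eq_zero_of_subsingleton [Subsingleton I] (h : IsLindblad Φ) : Φ = 0 := by
  classical
  refine LinearMap.ext fun A => ?_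
  obtain hI | ⟨⟨i⟩⟩ := isEmpty_or_nonempty I
  · exact Subsingleton.elim _ _
  · have hA : A = A i i • (1 : Matrix I I ℂ) := by
      ext a b
      simp [Subsingleton.elim a i, Subsingleton.elim b i]
    rw [hA, map_smul, h.map_one, smul_zero, LinearMap.zero_apply]

end Generator

section Functionals

variable {I J : Type*}

theorem linearMap_apply_eq_sum [Fintype I] [DecidableEq I] (f : Matrix I I ℂ →ₗ[ℂ] ℂ)
    (M : Matrix I I ℂ) : f M = ∑ p : I × I, M p.1 p.2 * f (Matrix.single p.1 p.2 1) := by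
  conv_lhs => rw [Matrix.matrix_eq_sum_single M]
  simp only [map_sum, Fintype.sum_prod_type]
  refine Finset.sum_congr rfl fun a _ => Finset.sum_congr rfl fun b _ => ?_
  rw [← smul_eq_mul, ← map_smul, Matrix.smul_single, smul_eq_mul, mul_one]

theorem linearMap_apply_comm [Finite I] [Finite J] (f : Matrix I I ℂ →ₗ[ℂ] ℂ)
    (g : Matrix J J ℂ →ₗ[ℂ] ℂ) (N : I → I → J → J → ℂ) :
    f (Matrix.of fun a b => g (Matrix.of fun c d => N a b c d)) =
      g (Matrix.of fun c d => f (Matrix.of fun a b => N a b c d)) := by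
  classical
  have := Fintype.ofFinite I
  have := Fintype.ofFinite J
  have expand_f (c d) := linearMap_apply_eq_sum f (Matrix.of fun a b => N a b c d)
  have expand_g (a b) := linearMap_apply_eq_sum g (Matrix.of fun c d => N a b c d)
  rw [linearMap_apply_eq_sum f, linearMap_apply_eq_sum g]
  simp only [Matrix.of_apply, expand_f, expand_g, Finset.sum_mul]
  rw [Finset.sum_comm]
  exact Finset.sum_congr rfl fun _ _ => Finset.sum_congr rfl fun _ _ => mul_right_comm _ _ _

end Functionals

section Extend

variable {Γ : Type*} [DecidableEq Γ] {ι : Γ → Type*} {X Y Z Λ : Finset Γ}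

/-- The identification of the configurations over `Λ` with the pairs of a configuration over
`Λ \ Z` and one over `Z`. -/
def splitEquiv (h : Z ⊆ Λ) : Config ι Λ ≃ Config ι (Λ \ Z) × Config ι Z where
  toFun σ := (restrict Finset.sdiff_subset σ, restrict h σ)
  invFun p := fun x => if hx : (x : Γ) ∈ Z then p.2 ⟨x, hx⟩
    else p.1 ⟨x, Finset.mem_sdiff.2 ⟨x.2, hx⟩⟩
  left_inv σ := by
    funext x
    by_cases hx : (x : Γ) ∈ Z <;> simp [restrict, hx]
  right_inv p := by
    refine Prod.ext (funext fun x => ?_) (funext fun x => ?_)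
    · simp [restrict, (Finset.mem_sdiff.1 x.2).2]
    · simp [restrict, x.2]

theorem splitEquiv_symm_apply (h : Z ⊆ Λ) (a : Config ι Z) (σ : Config ι Λ) :
    (splitEquiv h).symm ((splitEquiv h σ).1, a) = glue a σ := by
  funext x
  by_cases hx : (x : Γ) ∈ Z <;> simp [splitEquiv, glue, restrict, hx]

theorem splitEquiv_fst_eq_iff (h : Z ⊆ Λ) (σ τ : Config ι Λ) :
    (splitEquiv h σ).1 = (splitEquiv h τ).1 ↔ ∀ x : Λ, (x : Γ) ∉ Z → σ x = τ x := by
  refine ⟨fun H x hx => congrFun H ⟨x, Finset.mem_sdiff.2 ⟨x.2, hx⟩⟩, fun H => funext fun x => ?_⟩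
  exact H ⟨x, Finset.sdiff_subset x.2⟩ (Finset.mem_sdiff.1 x.2).2

theorem restrict_glue_of_disjoint (hY : Y ⊆ Λ) (hd : Disjoint Y Z) (a : Config ι Z)
    (σ : Config ι Λ) : restrict hY (glue a σ) = restrict hY σ := by
  funext x
  simp [restrict, glue, Finset.disjoint_left.1 hd x.2]

theorem glue_comm (hd : Disjoint Y Z) (a : Config ι Z) (b : Config ι Y) (σ : Config ι Λ) :
    glue a (glue b σ) = glue b (glue a σ) := by
  funext x
  by_cases hx : (x : Γ) ∈ Z
  · simp [glue, hx, Finset.disjoint_right.1 hd hx]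
  · simp [glue, hx]

theorem glue_eq_glue_off_iff (hZ : Z ⊆ Λ) (hd : Disjoint X Z) (a b : Config ι Z)
    (σ τ : Config ι Λ) : (∀ x : Λ, (x : Γ) ∉ X → glue a σ x = glue b τ x) ↔
      a = b ∧ ∀ x : Λ, (x : Γ) ∉ X → (x : Γ) ∉ Z → σ x = τ x := by
  refine ⟨fun H => ⟨funext fun x => ?_, fun x hx hz => ?_⟩, ?_⟩
  · simpa [glue] using H ⟨x, hZ x.2⟩ (Finset.disjoint_right.1 hd x.2)
  · simpa [glue, hz] using H x hx
  · rintro ⟨rfl, H⟩ x hx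
    by_cases hz : (x : Γ) ∈ Z
    · simp [glue, hz]
    · simpa [glue, hz] using H x hx hz

theorem extend_comm [∀ x, Finite (ι x)] (hY : Y ⊆ Λ) (hZ : Z ⊆ Λ) (hd : Disjoint Y Z)
    (Φ : Obs ι Y →ₗ[ℂ] Obs ι Y) (Ψ : Obs ι Z →ₗ[ℂ] Obs ι Z) (M : Obs ι Λ) :
    extend hY Φ (extend hZ Ψ M) = extend hZ Ψ (extend hY Φ M) := by
  ext σ τ
  have fubini := linearMap_apply_comm
    (Matrix.entryLinearMap ℂ ℂ (restrict hY σ) (restrict hY τ) ∘ₗ Φ)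
    (Matrix.entryLinearMap ℂ ℂ (restrict hZ σ) (restrict hZ τ) ∘ₗ Ψ)
    fun a b c d => M (glue c (glue a σ)) (glue d (glue b τ))
  simpa only [extend, LinearMap.coe_mk, AddHom.coe_mk, LinearMap.comp_apply,
    Matrix.entryLinearMap_apply, Matrix.of_apply, restrict_glue_of_disjoint hZ hd.symm,
    restrict_glue_of_disjoint hY hd, glue_comm hd] using fubini

theorem extend_embed_eq_zero [∀ x, DecidableEq (ι x)] (hZ : Z ⊆ Λ) (hX : X ⊆ Λ) (hd : Disjoint X Z)
    {Φ : Obs ι Z →ₗ[ℂ] Obs ι Z} (hΦ : Φ 1 = 0) (A : Obs ι X) :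
    extend hZ Φ (embed hX A) = 0 := by
  ext σ τ
  have block_eq_smul_one : (Matrix.of fun a b => embed hX A (glue a σ) (glue b τ) : Obs ι Z) =
      (if ∀ x : Λ, (x : Γ) ∉ X → (x : Γ) ∉ Z → σ x = τ x then
        A (restrict hX σ) (restrict hX τ) else 0) • (1 : Obs ι Z) := by
    ext a b
    simp only [embed, Matrix.of_apply, glue_eq_glue_off_iff hZ hd,
      restrict_glue_of_disjoint hX hd, ite_and, Matrix.smul_apply, Matrix.one_apply, smul_eq_mul,
      mul_ite, mul_one, mul_zero]
  simp only [extend, LinearMap.coe_mk, AddHom.coe_mk, Matrix.of_apply, block_eq_smul_one,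
    map_smul, hΦ, smul_zero, Matrix.zero_apply]

variable [∀ x, Fintype (ι x)]

variable (ι) in
/-- The splitting of a configuration, with the outer configurations numbered as required by
`amplify`. -/
noncomputable def splitFin (h : Z ⊆ Λ) :
    Config ι Λ ≃ Fin (Fintype.card (Config ι (Λ \ Z))) × Config ι Z :=
  (splitEquiv h).trans ((Fintype.equivFin _).prodCongr (Equiv.refl _))

theorem splitFin_apply_snd (h : Z ⊆ Λ) (σ : Config ι Λ) : (splitFin ι h σ).2 = restrict h σ := rfl

theorem splitFin_fst_eq_iff (h : Z ⊆ Λ) (σ τ : Config ι Λ) :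
    (splitFin ι h σ).1 = (splitFin ι h τ).1 ↔ ∀ x : Λ, (x : Γ) ∉ Z → σ x = τ x := by
  rw [← splitEquiv_fst_eq_iff h]
  exact (Fintype.equivFin _).apply_eq_iff_eq

theorem splitFin_symm_apply (h : Z ⊆ Λ) (a : Config ι Z) (σ : Config ι Λ) :
    (splitFin ι h).symm ((splitFin ι h σ).1, a) = glue a σ := by
  simp [splitFin, splitEquiv_symm_apply]

theorem extend_eq_amplify (h : Z ⊆ Λ) (Φ : Obs ι Z →ₗ[ℂ] Obs ι Z) (M : Obs ι Λ) :
    extend h Φ M = (amplify _ Φ (M.submatrix (splitFin ι h).symm (splitFin ι h).symm)).submatrix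
      (splitFin ι h) (splitFin ι h) := by
  ext σ τ
  simp only [extend, amplify, LinearMap.coe_mk, AddHom.coe_mk, Matrix.of_apply,
    Matrix.submatrix_apply, splitFin_symm_apply, splitFin_apply_snd]

variable [∀ x, DecidableEq (ι x)]

theorem embed_eq_kronecker (h : Z ⊆ Λ) (A : Obs ι Z) :
    embed h A = ((1 : Matrix (Fin _) (Fin _) ℂ) ⊗ₖ A).submatrix (splitFin ι h) (splitFin ι h) := by
  ext σ τ
  simp only [embed, Matrix.of_apply, Matrix.submatrix_apply, Matrix.kroneckerMap_apply,
    Matrix.one_apply, splitFin_fst_eq_iff, splitFin_apply_snd, ite_mul, one_mul, zero_mul]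

theorem norm_embed_le (h : Z ⊆ Λ) (A : Obs ι Z) : ‖embed h A‖ ≤ ‖A‖ := by
  rw [embed_eq_kronecker, norm_submatrix_equiv]
  exact norm_one_kronecker_le A

theorem norm_extend_le (h : Z ⊆ Λ) {Φ : Obs ι Z →ₗ[ℂ] Obs ι Z} (hΦ : cbNorm Φ ≠ ∞)
    (M : Obs ι Λ) : ‖extend h Φ M‖ ≤ (cbNorm Φ).toReal * ‖M‖ := by
  set n := Fintype.card (Config ι (Λ \ Z))
  have hn : ‖(amplify n Φ).toContinuousLinearMap‖ ≤ (cbNorm Φ).toReal :=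
    (ENNReal.ofReal_le_iff_le_toReal hΦ).1
      (le_iSup (fun n => ENNReal.ofReal ‖(amplify n Φ).toContinuousLinearMap‖) n)
  rw [extend_eq_amplify, norm_submatrix_equiv, ← norm_submatrix_equiv (splitFin ι h).symm M]
  exact (amplify n Φ).toContinuousLinearMap.le_of_opNorm_le hn _

theorem IsLindblad.isDissipative_extend (h : Z ⊆ Λ) {Φ : Obs ι Z →ₗ[ℂ] Obs ι Z}
    (hΦ : IsLindblad Φ) : IsDissipative (extend h Φ) := by
  let e : Obs ι Λ ≃ₗᵢ[ℝ] Matrix (Fin (Fintype.card (Config ι (Λ \ Z))) × Config ι Z) _ ℂ :=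
    { Matrix.reindexLinearEquiv ℝ ℂ (splitFin ι h) (splitFin ι h) with
      norm_map' := norm_submatrix_equiv (splitFin ι h).symm }
  have hconj : ⇑(extend h Φ) = fun M => e.symm (OpenSpin.amplify _ Φ (e M)) :=
    funext (extend_eq_amplify h Φ)
  rw [hconj]
  exact (hΦ.amplify _).isDissipative.conj e

end Extend

section Hopping

variable {Γ : Type*} [DecidableEq Γ] {𝒵 : Finset (Finset Γ)} {c : Finset Γ → ℝ}

theorem sum_mul_sum_eq_sum_mul {Λ : Finset Γ} (h𝒵 : ∀ W ∈ 𝒵, W ⊆ Λ) (g : Γ → ℝ) :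
    ∑ W ∈ 𝒵, c W * ∑ z ∈ W, g z = ∑ z ∈ Λ, (∑ W ∈ 𝒵 with z ∈ W, c W) * g z := by
  simp only [Finset.mul_sum, Finset.sum_mul]
  refine Finset.sum_comm' fun W z => ?_
  simp only [Finset.mem_filter]
  exact ⟨fun h => ⟨h, h𝒵 W h.1 h.2⟩, fun h => h.1⟩

variable (𝒵 c)

/-- The hopping operator of a weighted family of sets: the operator on functions on `Γ` that lets
a particle jump within the sets `W` of the family `𝒵`, with rate `c W`. -/
def hop : (Γ → ℝ) →ₗ[ℝ] (Γ → ℝ) where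
  toFun g y := ∑ W ∈ 𝒵 with y ∈ W, c W * ∑ z ∈ W, g z
  map_add' g g' := by
    funext y
    simp [Finset.sum_add_distrib, mul_add]
  map_smul' a g := by
    funext y
    simp only [Pi.smul_apply, smul_eq_mul, ← Finset.mul_sum, RingHom.id_apply]
    rw [Finset.mul_sum]
    exact Finset.sum_congr rfl fun W _ => mul_left_comm _ _ _

theorem hop_apply (g : Γ → ℝ) (y : Γ) :
    hop 𝒵 c g y = ∑ W ∈ 𝒵 with y ∈ W, c W * ∑ z ∈ W, g z := rfl

variable {𝒵 c}

theorem hop_eq_sum {Λ : Finset Γ} (h𝒵 : ∀ W ∈ 𝒵, W ⊆ Λ) (g : Γ → ℝ) (y : Γ) :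
    hop 𝒵 c g y = ∑ z ∈ Λ, (∑ W ∈ 𝒵 with y ∈ W ∧ z ∈ W, c W) * g z := by
  rw [hop_apply, sum_mul_sum_eq_sum_mul fun W hW => h𝒵 W (Finset.mem_filter.1 hW).1]
  simp only [Finset.filter_filter]

theorem hop_nonneg (hc : ∀ W, 0 ≤ c W) {g : Γ → ℝ} (hg : 0 ≤ g) : 0 ≤ hop 𝒵 c g := fun _ =>
  Finset.sum_nonneg fun W _ => mul_nonneg (hc W) (Finset.sum_nonneg fun z _ => hg z)

theorem hop_pow_nonneg (hc : ∀ W, 0 ≤ c W) {g : Γ → ℝ} (hg : 0 ≤ g) (n : ℕ) :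
    0 ≤ (hop 𝒵 c ^ n) g := by
  induction n with
  | zero => exact hg
  | succ n ih =>
    rw [pow_succ']
    exact hop_nonneg hc ih

theorem hop_pow_one_le (hc : ∀ W, 0 ≤ c W) (n : ℕ) (y : Γ) :
    (hop 𝒵 c ^ n) 1 y ≤ (∑ W ∈ 𝒵, c W * W.card) ^ n := by
  set κ := ∑ W ∈ 𝒵, c W * (W.card : ℝ)
  have hκ : 0 ≤ κ := Finset.sum_nonneg fun W _ => mul_nonneg (hc W) (Nat.cast_nonneg _)
  induction n generalizing y with
  | zero => simp
  | succ n ih =>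
    calc (hop 𝒵 c ^ (n + 1)) 1 y
        = ∑ W ∈ 𝒵 with y ∈ W, c W * ∑ z ∈ W, (hop 𝒵 c ^ n) 1 z := by
          rw [pow_succ', Module.End.mul_apply, hop_apply]
      _ ≤ ∑ W ∈ 𝒵 with y ∈ W, c W * (W.card * κ ^ n) := by
          refine Finset.sum_le_sum fun W _ => mul_le_mul_of_nonneg_left ?_ (hc W)
          exact (Finset.sum_le_card_nsmul _ _ _ fun z _ => ih z).trans_eq (nsmul_eq_mul _ _)
      _ ≤ ∑ W ∈ 𝒵, c W * (W.card * κ ^ n) :=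
          Finset.sum_le_sum_of_subset_of_nonneg (Finset.filter_subset _ _) fun W _ _ =>
            mul_nonneg (hc W) (by positivity)
      _ = κ ^ (n + 1) := by
          rw [pow_succ', Finset.sum_mul]
          exact Finset.sum_congr rfl fun W _ => (mul_assoc _ _ _).symm

theorem sum_not_disjoint_le_sum_hop (hc : ∀ W, 0 ≤ c W) {g : Γ → ℝ} (hg : 0 ≤ g)
    (Z : Finset Γ) :
    ∑ W ∈ 𝒵 with ¬ Disjoint W Z, c W * ∑ z ∈ W, g z ≤ ∑ y ∈ Z, hop 𝒵 c g y := by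
  have weight_nonneg (W : Finset Γ) : 0 ≤ c W * ∑ z ∈ W, g z :=
    mul_nonneg (hc W) (Finset.sum_nonneg fun z _ => hg z)
  have swap : ∑ y ∈ Z, hop 𝒵 c g y =
      ∑ W ∈ 𝒵, ∑ y ∈ Z, if y ∈ W then c W * ∑ z ∈ W, g z else 0 := by
    simp only [hop_apply, Finset.sum_filter (p := fun W => _ ∈ W)]
    exact Finset.sum_comm
  rw [swap, Finset.sum_filter]
  refine Finset.sum_le_sum fun W _ => ?_
  split_ifs with hW
  · exact Finset.sum_nonneg fun y _ => ite_nonneg (weight_nonneg W) le_rfl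
  · obtain ⟨y, hyW, hyZ⟩ := Finset.not_disjoint_iff.1 hW
    refine le_trans (if_pos hyW).ge (Finset.single_le_sum (f := fun y =>
      if y ∈ W then c W * ∑ z ∈ W, g z else 0) (fun y _ => ?_) hyZ)
    exact ite_nonneg (weight_nonneg W) le_rfl

variable (𝒵 c) in
/-- The Taylor polynomial of order `N` of `exp (t • hop 𝒵 c) g`, plus a remainder in which `g` is
replaced by the constant function `1`. -/
noncomputable def hopSum (g : Γ → ℝ) (N : ℕ) (t : ℝ) : Γ → ℝ :=
  ∑ n ∈ Finset.range N, (t ^ n / n !) • (hop 𝒵 c ^ n) g + (t ^ N / N !) • (hop 𝒵 c ^ N) 1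

theorem hopSum_apply (g : Γ → ℝ) (N : ℕ) (t : ℝ) (y : Γ) : hopSum 𝒵 c g N t y =
    ∑ n ∈ Finset.range N, t ^ n / n ! * (hop 𝒵 c ^ n) g y + t ^ N / N ! * (hop 𝒵 c ^ N) 1 y := by
  simp [hopSum, Finset.sum_apply]

theorem hopSum_zero (g : Γ → ℝ) (t : ℝ) : hopSum 𝒵 c g 0 t = 1 := by
  simp [hopSum]

theorem hopSum_succ_zero (g : Γ → ℝ) (N : ℕ) : hopSum 𝒵 c g (N + 1) 0 = g := by
  simp [hopSum, Finset.sum_range_succ']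

theorem hopSum_nonneg (hc : ∀ W, 0 ≤ c W) {g : Γ → ℝ} (hg : 0 ≤ g) (N : ℕ) {t : ℝ}
    (ht : 0 ≤ t) : 0 ≤ hopSum 𝒵 c g N t :=
  add_nonneg
    (Finset.sum_nonneg fun n _ => smul_nonneg (by positivity) (hop_pow_nonneg hc hg n))
    (smul_nonneg (by positivity) (hop_pow_nonneg hc zero_le_one N))

theorem hasDerivAt_pow_div_factorial (n : ℕ) (t : ℝ) :
    HasDerivAt (fun s : ℝ => s ^ (n + 1) / ((n + 1)! : ℝ)) (t ^ n / (n ! : ℝ)) t := by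
  refine ((hasDerivAt_pow (n + 1) t).div_const _).congr_deriv ?_
  have : (n ! : ℝ) ≠ 0 := Nat.cast_ne_zero.2 n.factorial_ne_zero
  rw [Nat.factorial_succ]
  push_cast
  field_simp

theorem hasDerivAt_hopSum (g : Γ → ℝ) (N : ℕ) (t : ℝ) (y : Γ) :
    HasDerivAt (fun s => hopSum 𝒵 c g (N + 1) s y) (hop 𝒵 c (hopSum 𝒵 c g N t) y) t := by
  have split (s) : hopSum 𝒵 c g (N + 1) s y =
      (∑ n ∈ Finset.range N, s ^ (n + 1) / (n + 1)! * (hop 𝒵 c ^ (n + 1)) g y + g y) +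
      s ^ (N + 1) / (N + 1)! * (hop 𝒵 c ^ (N + 1)) 1 y := by
    rw [hopSum_apply, Finset.sum_range_succ']
    simp
  have hop_hopSum : hop 𝒵 c (hopSum 𝒵 c g N t) y =
      (∑ n ∈ Finset.range N, t ^ n / n ! * (hop 𝒵 c ^ (n + 1)) g y) +
      t ^ N / N ! * (hop 𝒵 c ^ (N + 1)) 1 y := by
    simp [hopSum, map_add, map_sum, map_smul, Finset.sum_apply, pow_succ', Module.End.mul_apply]
  simp only [split, hop_hopSum]
  exact ((HasDerivAt.fun_sum fun n _ =>
    (hasDerivAt_pow_div_factorial n t).mul_const _).add_const _).add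
    ((hasDerivAt_pow_div_factorial N t).mul_const _)

end Hopping

section Propagation

open Filter Topology

variable {Γ : Type*} {E : Type*} [NormedAddCommGroup E] [NormedSpace ℝ E]

/-- A family of dissipative operators labelled by finite sets, with norm bounds `c`, whose members
commute when their labels are disjoint. Abstracts the local generators of a dissipative quantum
spin system. -/
structure IsLocalFamily (D : Finset Γ → E →L[ℝ] E) (c : Finset Γ → ℝ) : Prop where
  nonneg : ∀ Z, 0 ≤ c Z
  norm_le : ∀ Z A, ‖D Z A‖ ≤ c Z * ‖A‖
  map_empty : D ∅ = 0
  dissipative : ∀ Z, IsDissipative (D Z)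
  comm : ∀ Y Z, Disjoint Y Z → ∀ A, D Y (D Z A) = D Z (D Y A)

variable {D : Finset Γ → E →L[ℝ] E} {c : Finset Γ → ℝ} {𝒵 𝒮 : Finset (Finset Γ)}

theorem IsLocalFamily.dissipative_sum (h : IsLocalFamily D c) (𝒵 : Finset (Finset Γ)) :
    IsDissipative fun A => ∑ W ∈ 𝒵, D W A := by
  have hsum : (fun A => ∑ W ∈ 𝒵, D W A) = ∑ W ∈ 𝒵, ⇑(D W) := by
    ext A
    rw [Finset.sum_apply]
  rw [hsum]
  exact IsDissipative.sum fun W _ => h.dissipative W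

theorem IsLocalFamily.norm_solution_le (h : IsLocalFamily D c) {T : ℝ → E}
    (hT : ∀ s, HasDerivAt T (∑ W ∈ 𝒵, D W (T s)) s) {t : ℝ} (ht : 0 ≤ t) : ‖T t‖ ≤ ‖T 0‖ :=
  (h.dissipative_sum 𝒵).norm_le_of_hasDerivAt (g := 0) (B' := 0) ht
    (fun s => (hT s).congr_deriv (add_zero _).symm) (fun s => hasDerivAt_const s ‖T 0‖) le_rfl
    fun _ _ => norm_zero.le

theorem IsLocalFamily.norm_apply_le_indicator (h : IsLocalFamily D c) {X : Finset Γ} {A : E}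
    (hA : ∀ Z, Disjoint X Z → D Z A = 0) (Z : Finset Γ) :
    ‖D Z A‖ ≤ c Z * ‖A‖ * ∑ y ∈ Z, (X : Set Γ).indicator 1 y := by
  have nonneg (y : Γ) : (0 : ℝ) ≤ (X : Set Γ).indicator 1 y :=
    Set.indicator_nonneg (fun _ _ => zero_le_one) y
  have const_nonneg := mul_nonneg (h.nonneg Z) (norm_nonneg A)
  by_cases hXZ : Disjoint X Z
  · rw [hA Z hXZ, norm_zero]
    exact mul_nonneg const_nonneg (Finset.sum_nonneg fun y _ => nonneg y)
  · obtain ⟨x, hxX, hxZ⟩ := Finset.not_disjoint_iff.1 hXZ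
    refine (h.norm_le Z A).trans (le_mul_of_one_le_right const_nonneg ?_)
    calc (1 : ℝ) = (X : Set Γ).indicator 1 x := by simp [hxX]
      _ ≤ _ := Finset.single_le_sum (fun y _ => nonneg y) hxZ

variable [DecidableEq Γ]

theorem IsLocalFamily.norm_solution_sub_le (h : IsLocalFamily D c) (h𝒮 : 𝒮 ⊆ 𝒵) {T T' : ℝ → E}
    (hT : ∀ s, HasDerivAt T (∑ W ∈ 𝒵, D W (T s)) s)
    (hT' : ∀ s, HasDerivAt T' (∑ W ∈ 𝒮, D W (T' s)) s) (h0 : T 0 = T' 0) {B B' : ℝ → ℝ}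
    (hB : ∀ s, HasDerivAt B (B' s) s) (hB0 : B 0 = 0)
    (hle : ∀ s, 0 ≤ s → ∑ W ∈ 𝒵 \ 𝒮, ‖D W (T' s)‖ ≤ B' s) {t : ℝ} (ht : 0 ≤ t) :
    ‖T t - T' t‖ ≤ B t := by
  refine (h.dissipative_sum 𝒵).norm_le_of_hasDerivAt (f := fun s => T s - T' s)
    (g := fun s => ∑ W ∈ 𝒵 \ 𝒮, D W (T' s)) ht (fun s => ?_) hB
    (by rw [h0, sub_self, norm_zero, hB0])
    (fun s hs => (norm_sum_le _ _).trans (hle s hs.1))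
  refine ((hT s).sub (hT' s)).congr_deriv ?_
  simp only [map_sub, Finset.sum_sub_distrib, ← Finset.sum_sdiff h𝒮 (f := fun W => D W (T' s))]
  abel

theorem IsLocalFamily.apply_sum_eq (h : IsLocalFamily D c) (Z : Finset Γ) (A : E) :
    D Z (∑ W ∈ 𝒵, D W A) =
      (∑ W ∈ 𝒵 with Disjoint W Z, D W (D Z A)) + D Z (∑ W ∈ 𝒵 with ¬ Disjoint W Z, D W A) := by
  rw [← Finset.sum_filter_add_sum_filter_not 𝒵 (Disjoint · Z), map_add, map_sum]
  congr 1
  exact Finset.sum_congr rfl fun W hW => h.comm Z W (Finset.mem_filter.1 hW).2.symm A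

/-- One step of the iteration behind the Lieb–Robinson bound: the terms of the generator that
are disjoint from `Z` commute with `D Z` and, being dissipative, do not contribute. -/
theorem IsLocalFamily.norm_apply_solution_le_of_hop (h : IsLocalFamily D c) {T : ℝ → E}
    (hT : ∀ s, HasDerivAt T (∑ W ∈ 𝒵, D W (T s)) s) {u U : ℝ → Γ → ℝ}
    (hU : ∀ s y, HasDerivAt (fun s => U s y) (hop 𝒵 c (u s) y) s)
    (hU0 : ∀ Z, ‖D Z (T 0)‖ ≤ c Z * ‖T 0‖ * ∑ y ∈ Z, U 0 y) (hu0 : ∀ s, 0 ≤ s → 0 ≤ u s)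
    (hu : ∀ s, 0 ≤ s → ∀ Z, ‖D Z (T s)‖ ≤ c Z * ‖T 0‖ * ∑ y ∈ Z, u s y) {t : ℝ} (ht : 0 ≤ t)
    (Z : Finset Γ) : ‖D Z (T t)‖ ≤ c Z * ‖T 0‖ * ∑ y ∈ Z, U t y := by
  refine (h.dissipative_sum (𝒵.filter (Disjoint · Z))).norm_le_of_hasDerivAt
    (f := fun s => D Z (T s)) (B := fun s => c Z * ‖T 0‖ * ∑ y ∈ Z, U s y) ht
    (fun s => ((D Z).hasFDerivAt.comp_hasDerivAt s (hT s)).congr_deriv (h.apply_sum_eq Z (T s)))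
    (fun s => (HasDerivAt.fun_sum fun y _ => hU s y).const_mul _) (hU0 Z) fun s hs => ?_
  calc ‖D Z (∑ W ∈ 𝒵 with ¬ Disjoint W Z, D W (T s))‖
      ≤ c Z * ‖∑ W ∈ 𝒵 with ¬ Disjoint W Z, D W (T s)‖ := h.norm_le _ _
    _ ≤ c Z * ∑ W ∈ 𝒵 with ¬ Disjoint W Z, ‖T 0‖ * (c W * ∑ z ∈ W, u s z) :=
        mul_le_mul_of_nonneg_left
          (norm_sum_le_of_le _ fun W _ => (hu s hs.1 W).trans_eq (by ring)) (h.nonneg Z)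
    _ = c Z * ‖T 0‖ * ∑ W ∈ 𝒵 with ¬ Disjoint W Z, c W * ∑ z ∈ W, u s z := by
        rw [← Finset.mul_sum, mul_assoc]
    _ ≤ c Z * ‖T 0‖ * ∑ y ∈ Z, hop 𝒵 c (u s) y :=
        mul_le_mul_of_nonneg_left (sum_not_disjoint_le_sum_hop h.nonneg (hu0 s hs.1) Z)
          (mul_nonneg (h.nonneg Z) (norm_nonneg _))

theorem IsLocalFamily.norm_apply_solution_le_hopSum (h : IsLocalFamily D c) {T : ℝ → E}
    (hT : ∀ s, HasDerivAt T (∑ W ∈ 𝒵, D W (T s)) s) {g : Γ → ℝ} (hg : 0 ≤ g)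
    (h0 : ∀ Z, ‖D Z (T 0)‖ ≤ c Z * ‖T 0‖ * ∑ y ∈ Z, g y) (N : ℕ) {t : ℝ} (ht : 0 ≤ t)
    (Z : Finset Γ) : ‖D Z (T t)‖ ≤ c Z * ‖T 0‖ * ∑ y ∈ Z, hopSum 𝒵 c g N t y := by
  induction N generalizing t Z with
  | zero =>
    rcases Z.eq_empty_or_nonempty with rfl | hZ
    · simp [h.map_empty]
    · simp only [hopSum_zero, Pi.one_apply, Finset.sum_const, nsmul_eq_mul, mul_one]
      calc ‖D Z (T t)‖ ≤ c Z * ‖T t‖ := h.norm_le _ _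
        _ ≤ c Z * ‖T 0‖ := mul_le_mul_of_nonneg_left (h.norm_solution_le hT ht) (h.nonneg Z)
        _ ≤ c Z * ‖T 0‖ * Z.card :=
            le_mul_of_one_le_right (mul_nonneg (h.nonneg Z) (norm_nonneg _))
              (Nat.one_le_cast.2 hZ.card_pos)
  | succ N ih =>
    refine h.norm_apply_solution_le_of_hop hT (hasDerivAt_hopSum g N) (fun Z => ?_)
      (fun s hs => hopSum_nonneg h.nonneg hg N hs) (fun s hs Z => ih hs Z) ht Z
    rw [hopSum_succ_zero]
    exact h0 Z

theorem IsLocalFamily.norm_apply_solution_le (h : IsLocalFamily D c) {T : ℝ → E}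
    (hT : ∀ s, HasDerivAt T (∑ W ∈ 𝒵, D W (T s)) s) {g : Γ → ℝ} (hg : 0 ≤ g)
    (h0 : ∀ Z, ‖D Z (T 0)‖ ≤ c Z * ‖T 0‖ * ∑ y ∈ Z, g y) {t : ℝ} (ht : 0 ≤ t) {Z : Finset Γ}
    {Q : Γ → ℝ}
    (hQ : ∀ y ∈ Z, ∀ N, ∑ n ∈ Finset.range N, t ^ n / n ! * (hop 𝒵 c ^ n) g y ≤ Q y) :
    ‖D Z (T t)‖ ≤ c Z * ‖T 0‖ * ∑ y ∈ Z, Q y := by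
  set κ : ℝ := ∑ W ∈ 𝒵, c W * W.card
  have lim : Tendsto (fun N : ℕ => c Z * ‖T 0‖ * ∑ y ∈ Z, (Q y + (t * κ) ^ N / N !)) atTop
      (𝓝 (c Z * ‖T 0‖ * ∑ y ∈ Z, (Q y + 0))) :=
    (tendsto_finsetSum _ fun y _ => tendsto_const_nhds.add
      (FloorSemiring.tendsto_pow_div_factorial_atTop (t * κ))).const_mul _
  simp only [add_zero] at lim
  refine ge_of_tendsto' lim fun N =>
    (h.norm_apply_solution_le_hopSum hT hg h0 N ht Z).trans
      (mul_le_mul_of_nonneg_left (Finset.sum_le_sum fun y hy => ?_)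
        (mul_nonneg (h.nonneg Z) (norm_nonneg _)))
  calc hopSum 𝒵 c g N t y ≤ Q y + t ^ N / N ! * κ ^ N := by
        rw [hopSum_apply]
        gcongr
        exacts [hQ y hy N, hop_pow_one_le h.nonneg N y]
    _ = Q y + (t * κ) ^ N / N ! := by rw [mul_pow, mul_div_right_comm]

end Propagation

section Decay

variable {Γ : Type*} [MetricSpace Γ] {F : ℝ → ℝ}

theorem IsFFunction.dist_pos (hF : IsFFunction Γ F) (x y : Γ) : 0 < F (dist x y) :=
  hF.pos _ dist_nonneg

theorem IsFFunction.inflation_finite (hF : IsFFunction Γ F) (X : Finset Γ) {r : ℝ} (hr : 0 ≤ r) :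
    (inflation X r).Finite := by
  have inflation_eq : inflation X r = ⋃ x ∈ X, {y | dist y x ≤ r} := by
    ext y
    simp [inflation]
  rw [inflation_eq]
  refine X.finite_toSet.biUnion fun x _ => ?_
  have summable : ∑' y : Γ, ENNReal.ofReal (F (dist x y)) ≠ ∞ :=
    ((le_iSup (fun x : Γ => ∑' y : Γ, ENNReal.ofReal (F (dist x y))) x).trans_lt hF.summable).ne
  refine (ENNReal.finite_const_le_of_tsum_ne_top summable
    (ENNReal.ofReal_pos.2 (hF.pos r hr)).ne').subset fun y (hy : dist y x ≤ r) => ?_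
  exact ENNReal.ofReal_le_ofReal (hF.antitone dist_nonneg hr ((dist_comm x y).trans_le hy))

theorem IsFFunction.sum_le_tail (hF : IsFFunction Γ F) {ρ : ℝ} {x : Γ} {s : Finset Γ}
    (hs : ∀ y ∈ s, ρ < dist x y) : ∑ y ∈ s, F (dist x y) ≤ tail Γ F ρ := by
  have tail_le (x : Γ) : ∑' y : {y : Γ // ρ < dist x y}, ENNReal.ofReal (F (dist x y)) ≤
      ⨆ x : Γ, ∑' y : Γ, ENNReal.ofReal (F (dist x y)) :=
    (ENNReal.tsum_comp_le_tsum_of_injective Subtype.val_injective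
      (fun y => ENNReal.ofReal (F (dist x y)))).trans
      (le_iSup (fun x : Γ => ∑' y : Γ, ENNReal.ofReal (F (dist x y))) x)
  refine (ENNReal.ofReal_le_iff_le_toReal ((iSup_le tail_le).trans_lt hF.summable).ne).1 ?_
  classical
  calc ENNReal.ofReal (∑ y ∈ s, F (dist x y))
      = ∑ y ∈ s.subtype (ρ < dist x ·), ENNReal.ofReal (F (dist x y)) := by
        rw [ENNReal.ofReal_sum_of_nonneg fun y _ => (hF.dist_pos x y).le,
          Finset.sum_subtype_of_mem (fun y => ENNReal.ofReal (F (dist x y))) hs]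
    _ ≤ ∑' y : {y : Γ // ρ < dist x y}, ENNReal.ofReal (F (dist x y)) := ENNReal.sum_le_tsum _
    _ ≤ _ := le_iSup (fun x : Γ => ∑' y : {y : Γ // ρ < dist x y}, ENNReal.ofReal (F (dist x y))) x

variable (Γ) in
theorem tail_nonneg (F : ℝ → ℝ) (ρ : ℝ) : 0 ≤ tail Γ F ρ :=
  ENNReal.toReal_nonneg

theorem IsFFunction.sum_mul_le (hF : IsFFunction Γ F) (s : Finset Γ) (x y : Γ) :
    ∑ z ∈ s, F (dist x z) * F (dist z y) ≤ convConst Γ F * F (dist x y) := by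
  rw [← div_le_iff₀ (hF.dist_pos x y)]
  refine le_csInf hF.conv ?_
  rintro C ⟨hC, hconv⟩
  rw [div_le_iff₀ (hF.dist_pos x y),
    ← ENNReal.ofReal_le_ofReal_iff (mul_pos hC (hF.dist_pos x y)).le,
    ENNReal.ofReal_sum_of_nonneg fun z _ => (mul_pos (hF.dist_pos x z) (hF.dist_pos z y)).le]
  exact (ENNReal.sum_le_tsum s).trans (hconv x y)

theorem IsFFunction.convConst_pos [Nonempty Γ] (hF : IsFFunction Γ F) : 0 < convConst Γ F := by
  obtain ⟨x⟩ := ‹Nonempty Γ›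
  have h := hF.sum_mul_le {x} x x
  rw [Finset.sum_singleton] at h
  exact (hF.dist_pos x x).trans_le (le_of_mul_le_mul_right h (hF.dist_pos x x))

variable (Γ) in
theorem convConst_nonneg (F : ℝ → ℝ) : 0 ≤ convConst Γ F :=
  Real.sInf_nonneg fun _ hC => hC.1.le

theorem IsFFunction.indicator_dist_nonneg (hF : IsFFunction Γ F) (s : Set ℝ) (x y : Γ) :
    0 ≤ s.indicator F (dist x y) :=
  Set.indicator_apply_nonneg fun _ => (hF.dist_pos x y).le

theorem IsFFunction.sum_indicator_mul_le (hF : IsFFunction Γ F) (s : Finset Γ) (a b : ℝ) (x y : Γ) :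
    ∑ z ∈ s, (Set.Iic a).indicator F (dist x z) * (Set.Iic b).indicator F (dist z y) ≤
      convConst Γ F * (Set.Iic (a + b)).indicator F (dist x y) := by
  by_cases hxy : dist x y ≤ a + b
  · rw [Set.indicator_of_mem (Set.mem_Iic.2 hxy)]
    refine (Finset.sum_le_sum fun z _ => ?_).trans (hF.sum_mul_le s x y)
    exact mul_le_mul (Set.indicator_apply_le' (fun _ => le_rfl) fun _ => (hF.dist_pos x z).le)
      (Set.indicator_apply_le' (fun _ => le_rfl) fun _ => (hF.dist_pos z y).le)
      (hF.indicator_dist_nonneg _ z y) (hF.dist_pos x z).le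
  · rw [Set.indicator_of_notMem (mt Set.mem_Iic.1 hxy), mul_zero]
    refine (Finset.sum_eq_zero fun z _ => ?_).le
    by_cases hxz : dist x z ≤ a
    · have hzy : ¬ dist z y ≤ b := fun h => hxy ((dist_triangle x z y).trans (add_le_add hxz h))
      rw [Set.indicator_of_notMem (mt Set.mem_Iic.1 hzy), mul_zero]
    · rw [Set.indicator_of_notMem (mt Set.mem_Iic.1 hxz), zero_mul]

end Decay

section ExpTail

theorem expTail_eq_exp_sub (t k : ℝ) :
    expTail t k = Real.exp t - ∑ n ∈ Finset.range ⌈k⌉₊, t ^ n / (n ! : ℝ) := by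
  have split := (Real.summable_pow_div_factorial t).sum_add_tsum_nat_add ⌈k⌉₊
  have exp_eq : Real.exp t = ∑' n : ℕ, t ^ n / (n ! : ℝ) := by
    rw [Real.exp_eq_exp_ℝ, NormedSpace.exp_eq_tsum_div]
  rw [exp_eq, ← split, expTail]
  simp only [add_comm ⌈k⌉₊, add_sub_cancel_left]

theorem sum_Ico_le_expTail {t : ℝ} (ht : 0 ≤ t) (k : ℝ) (N : ℕ) :
    ∑ n ∈ Finset.Ico ⌈k⌉₊ N, t ^ n / (n ! : ℝ) ≤ expTail t k := by
  rw [Finset.sum_Ico_eq_sum_range]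
  exact ((Real.summable_pow_div_factorial t).comp_injective
    (add_right_injective ⌈k⌉₊)).sum_le_tsum _ fun n _ =>
      div_nonneg (pow_nonneg ht _) (Nat.cast_nonneg _)

theorem expTail_nonneg {t : ℝ} (ht : 0 ≤ t) (k : ℝ) : 0 ≤ expTail t k :=
  tsum_nonneg fun _ => by positivity

theorem expTail_one_add {k : ℝ} (hk : 0 ≤ k) (t : ℝ) : expTail t (1 + k) =
    Real.exp t - (∑ n ∈ Finset.range ⌈k⌉₊, t ^ (n + 1) / ((n + 1)! : ℝ) + 1) := by
  rw [expTail_eq_exp_sub, add_comm 1 k, Nat.ceil_add_one hk, Finset.sum_range_succ']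
  simp

theorem hasDerivAt_expTail {k : ℝ} (hk : 0 ≤ k) (t : ℝ) :
    HasDerivAt (fun s => expTail s (1 + k)) (expTail t k) t := by
  simp only [expTail_one_add hk]
  rw [expTail_eq_exp_sub]
  exact (Real.hasDerivAt_exp t).sub
    ((HasDerivAt.fun_sum fun n _ => hasDerivAt_pow_div_factorial n t).add_const _)

theorem expTail_zero {k : ℝ} (hk : 0 ≤ k) : expTail 0 (1 + k) = 0 := by
  simp [expTail_one_add hk]

end ExpTail

section HopDecay

variable {Γ : Type*} [MetricSpace Γ] [DecidableEq Γ] {F : ℝ → ℝ} {𝒵 : Finset (Finset Γ)}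
  {c : Finset Γ → ℝ} {Λ X : Finset Γ} {M R r : ℝ} {y : Γ}

/-- The weights `c` of the sets in `𝒵` have `F`-norm at most `M`; for simplicity, `c` is required to
be nonnegative on all sets. -/
structure HasFBound (F : ℝ → ℝ) (𝒵 : Finset (Finset Γ)) (c : Finset Γ → ℝ) (M : ℝ) : Prop where
  nonneg : ∀ W, 0 ≤ c W
  sum_le : ∀ y z, ∑ W ∈ 𝒵 with y ∈ W ∧ z ∈ W, c W ≤ M * F (dist y z)

theorem HasFBound.mono {𝒮 : Finset (Finset Γ)} (hc : HasFBound F 𝒵 c M) (h𝒮 : 𝒮 ⊆ 𝒵) :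
    HasFBound F 𝒮 c M where
  nonneg := hc.nonneg
  sum_le y z := (Finset.sum_le_sum_of_subset_of_nonneg (Finset.filter_subset_filter _ h𝒮)
    fun W _ _ => hc.nonneg W).trans (hc.sum_le y z)

theorem HasFBound.sum_le_tail (hF : IsFFunction Γ F) (hM : 0 ≤ M) (hR : 0 ≤ R)
    (hc : HasFBound F 𝒵 c M) (hdiam : ∀ W ∈ 𝒵, R < Metric.diam (W : Set Γ)) (y : Γ) :
    ∑ W ∈ 𝒵 with y ∈ W, c W ≤ M * tail Γ F (R / 2) := by
  have exists_far (W) (hW : W ∈ 𝒵) : ∃ z ∈ W, R / 2 < dist y z := by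
    by_contra! near
    refine (hdiam W hW).not_ge (Metric.diam_le_of_forall_dist_le hR fun a ha b hb => ?_)
    linarith [near a ha, near b hb, dist_triangle_left a b y]
  set far := (𝒵.biUnion id).filter fun z => R / 2 < dist y z
  calc ∑ W ∈ 𝒵 with y ∈ W, c W
      ≤ ∑ W ∈ 𝒵 with y ∈ W, ∑ z ∈ far, if z ∈ W then c W else 0 := by
        refine Finset.sum_le_sum fun W hW => ?_
        have hW' := (Finset.mem_filter.1 hW).1
        obtain ⟨z, hzW, hz⟩ := exists_far W hW'
        refine (if_pos hzW).ge.trans (Finset.single_le_sum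
          (f := fun z => if z ∈ W then c W else 0) (fun z _ => ite_nonneg (hc.nonneg W) le_rfl)
          (Finset.mem_filter.2 ⟨Finset.mem_biUnion.2 ⟨W, hW', hzW⟩, hz⟩))
    _ = ∑ z ∈ far, ∑ W ∈ 𝒵 with y ∈ W ∧ z ∈ W, c W := by
        rw [Finset.sum_comm]
        exact Finset.sum_congr rfl fun z _ => by rw [← Finset.sum_filter, Finset.filter_filter]
    _ ≤ ∑ z ∈ far, M * F (dist y z) := Finset.sum_le_sum fun z _ => hc.sum_le y z
    _ ≤ M * tail Γ F (R / 2) := by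
        rw [← Finset.mul_sum]
        exact mul_le_mul_of_nonneg_left
          (hF.sum_le_tail fun z hz => (Finset.mem_filter.1 hz).2) hM

theorem sum_mem_mem_le_indicator (hc : HasFBound F 𝒵 c M)
    (hdiam : ∀ W ∈ 𝒵, Metric.diam (W : Set Γ) ≤ R) (y z : Γ) :
    ∑ W ∈ 𝒵 with y ∈ W ∧ z ∈ W, c W ≤ M * (Set.Iic R).indicator F (dist y z) := by
  by_cases hyz : dist y z ≤ R
  · rw [Set.indicator_of_mem (Set.mem_Iic.2 hyz)]
    exact hc.sum_le y z
  · rw [Set.indicator_of_notMem (mt Set.mem_Iic.1 hyz), mul_zero]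
    refine (Finset.sum_eq_zero fun W hW => absurd ?_ hyz).le
    obtain ⟨hW, hy, hz⟩ := Finset.mem_filter.1 hW
    exact (Metric.dist_le_diam_of_mem W.finite_toSet.isBounded hy hz).trans (hdiam W hW)

theorem hop_pow_succ_indicator_le (hF : IsFFunction Γ F) (hM : 0 ≤ M) (h𝒵 : ∀ W ∈ 𝒵, W ⊆ Λ)
    (hX : X ⊆ Λ) (hc : HasFBound F 𝒵 c M) (hdiam : ∀ W ∈ 𝒵, Metric.diam (W : Set Γ) ≤ R)
    (n : ℕ) (y : Γ) :
    (hop 𝒵 c ^ (n + 1)) ((X : Set Γ).indicator 1) y ≤ M * (M * convConst Γ F) ^ n *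
      ∑ x ∈ X, (Set.Iic ((n + 1) * R)).indicator F (dist y x) := by
  have : Nonempty Γ := ⟨y⟩
  set C := convConst Γ F
  have hC : 0 < C := hF.convConst_pos
  set k : ℝ → Γ → Γ → ℝ := fun ρ y z => (Set.Iic ρ).indicator F (dist y z)
  have entry_le := sum_mem_mem_le_indicator hc hdiam
  induction n generalizing y with
  | zero =>
    have hop_indicator : hop 𝒵 c ((X : Set Γ).indicator 1) y =
        ∑ x ∈ X, ∑ W ∈ 𝒵 with y ∈ W ∧ x ∈ W, c W := by
      rw [hop_eq_sum h𝒵, ← Finset.sum_subset hX fun z _ hz => by simp [hz]]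
      exact Finset.sum_congr rfl fun x hx => by simp [hx]
    simp only [zero_add, pow_one, pow_zero, mul_one, Nat.cast_zero, one_mul, hop_indicator,
      Finset.mul_sum]
    exact Finset.sum_le_sum fun x _ => entry_le y x
  | succ n ih =>
    have b_nonneg : 0 ≤ M * (M * C) ^ n := by positivity
    calc (hop 𝒵 c ^ (n + 1 + 1)) ((X : Set Γ).indicator 1) y
        = ∑ z ∈ Λ, (∑ W ∈ 𝒵 with y ∈ W ∧ z ∈ W, c W) *
            (hop 𝒵 c ^ (n + 1)) ((X : Set Γ).indicator 1) z := by
          rw [pow_succ', Module.End.mul_apply, hop_eq_sum h𝒵]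
      _ ≤ ∑ z ∈ Λ, M * k R y z * (M * (M * C) ^ n * ∑ x ∈ X, k ((n + 1) * R) z x) := by
          refine Finset.sum_le_sum fun z _ => mul_le_mul (entry_le y z) (ih z)
            (hop_pow_nonneg hc.nonneg (Set.indicator_nonneg fun _ _ => zero_le_one) _ z)
            (mul_nonneg hM (hF.indicator_dist_nonneg _ y z))
      _ = M * (M * (M * C) ^ n) * ∑ x ∈ X, ∑ z ∈ Λ, k R y z * k ((n + 1) * R) z x := by
          simp only [Finset.mul_sum]
          rw [Finset.sum_comm]
          exact Finset.sum_congr rfl fun x _ => Finset.sum_congr rfl fun z _ => by ring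
      _ ≤ M * (M * (M * C) ^ n) * ∑ x ∈ X, C * k (R + (n + 1) * R) y x := by
          refine mul_le_mul_of_nonneg_left (Finset.sum_le_sum fun x _ => ?_)
            (mul_nonneg hM b_nonneg)
          exact hF.sum_indicator_mul_le Λ R ((n + 1) * R) y x
      _ = M * (M * C) ^ (n + 1) * ∑ x ∈ X, k (((n + 1 : ℕ) + 1) * R) y x := by
          rw [← Finset.mul_sum]
          push_cast
          ring_nf

theorem hop_pow_indicator_eq_zero (hF : IsFFunction Γ F) (hM : 0 ≤ M) (h𝒵 : ∀ W ∈ 𝒵, W ⊆ Λ)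
    (hX : X ⊆ Λ) (hc : HasFBound F 𝒵 c M) (hdiam : ∀ W ∈ 𝒵, Metric.diam (W : Set Γ) ≤ R)
    {n : ℕ} (hy : ∀ x ∈ X, n * R < dist y x) :
    (hop 𝒵 c ^ n) ((X : Set Γ).indicator 1) y = 0 := by
  cases n with
  | zero =>
    have hyX : y ∉ X := fun h => by simpa using hy y h
    simp [hyX]
  | succ n =>
    refine le_antisymm ((hop_pow_succ_indicator_le hF hM h𝒵 hX hc hdiam n y).trans_eq ?_)
      (hop_pow_nonneg hc.nonneg (Set.indicator_nonneg fun _ _ => zero_le_one) _ y)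
    refine mul_eq_zero_of_right _ (Finset.sum_eq_zero fun x hx => Set.indicator_of_notMem ?_ F)
    exact_mod_cast not_le.2 (hy x hx)

theorem hop_pow_indicator_le (hF : IsFFunction Γ F) (hM : 0 ≤ M) (h𝒵 : ∀ W ∈ 𝒵, W ⊆ Λ)
    (hX : X ⊆ Λ) (hc : HasFBound F 𝒵 c M) (hdiam : ∀ W ∈ 𝒵, Metric.diam (W : Set Γ) ≤ R)
    (hy : y ∉ X) (n : ℕ) :
    (hop 𝒵 c ^ n) ((X : Set Γ).indicator 1) y ≤
      (M * convConst Γ F) ^ n / convConst Γ F * ∑ x ∈ X, F (dist x y) := by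
  have : Nonempty Γ := ⟨y⟩
  have hC : 0 < convConst Γ F := hF.convConst_pos
  cases n with
  | zero =>
    have sum_nonneg : 0 ≤ ∑ x ∈ X, F (dist x y) :=
      Finset.sum_nonneg fun x _ => (hF.dist_pos x y).le
    simp only [pow_zero, Module.End.one_apply, Finset.mem_coe, hy, not_false_eq_true,
      Set.indicator_of_notMem]
    positivity
  | succ n =>
    calc (hop 𝒵 c ^ (n + 1)) ((X : Set Γ).indicator 1) y
        ≤ M * (M * convConst Γ F) ^ n *
            ∑ x ∈ X, (Set.Iic ((n + 1) * R)).indicator F (dist y x) :=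
          hop_pow_succ_indicator_le hF hM h𝒵 hX hc hdiam n y
      _ ≤ M * (M * convConst Γ F) ^ n * ∑ x ∈ X, F (dist x y) := by
          refine mul_le_mul_of_nonneg_left (Finset.sum_le_sum fun x _ => ?_) (by positivity)
          rw [dist_comm y x]
          exact Set.indicator_apply_le' (fun _ => le_rfl) fun _ => (hF.dist_pos x y).le
      _ = (M * convConst Γ F) ^ (n + 1) / convConst Γ F * ∑ x ∈ X, F (dist x y) := by
          rw [pow_succ (M * convConst Γ F) n]
          field_simp

theorem sum_hop_pow_indicator_le (hF : IsFFunction Γ F) (hM : 0 ≤ M) (h𝒵 : ∀ W ∈ 𝒵, W ⊆ Λ)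
    (hX : X ⊆ Λ) (hc : HasFBound F 𝒵 c M) (hdiam : ∀ W ∈ 𝒵, Metric.diam (W : Set Γ) ≤ R)
    (hr : 0 ≤ r) (hR : 0 < R) (hy : y ∉ inflation X r) {t : ℝ} (ht : 0 ≤ t) (N : ℕ) :
    ∑ n ∈ Finset.range N, t ^ n / n ! * (hop 𝒵 c ^ n) ((X : Set Γ).indicator 1) y ≤
      expTail (M * convConst Γ F * t) (r / R) / convConst Γ F * ∑ x ∈ X, F (dist x y) := by
  have : Nonempty Γ := ⟨y⟩
  set C := convConst Γ F
  have hC : 0 < C := hF.convConst_pos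
  have far (x) (hx : x ∈ X) : r < dist y x := not_le.1 fun h => hy ⟨x, hx, h⟩
  have hyX : y ∉ X := fun h => hy ⟨y, h, (dist_self y).trans_le hr⟩
  have below_eq_zero (n) (hn : n < ⌈r / R⌉₊) :
      (hop 𝒵 c ^ n) ((X : Set Γ).indicator 1) y = 0 :=
    hop_pow_indicator_eq_zero hF hM h𝒵 hX hc hdiam fun x hx =>
      ((lt_div_iff₀ hR).1 (Nat.lt_ceil.1 hn)).trans (far x hx)
  calc ∑ n ∈ Finset.range N, t ^ n / n ! * (hop 𝒵 c ^ n) ((X : Set Γ).indicator 1) y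
      = ∑ n ∈ Finset.Ico ⌈r / R⌉₊ N,
          t ^ n / n ! * (hop 𝒵 c ^ n) ((X : Set Γ).indicator 1) y := by
        refine (Finset.sum_subset (fun n hn => Finset.mem_range.2 (Finset.mem_Ico.1 hn).2)
          fun n hn hn' => ?_).symm
        rw [below_eq_zero n (not_le.1 fun h =>
          hn' (Finset.mem_Ico.2 ⟨h, Finset.mem_range.1 hn⟩)), mul_zero]
    _ ≤ ∑ n ∈ Finset.Ico ⌈r / R⌉₊ N, t ^ n / n ! * ((M * C) ^ n / C * ∑ x ∈ X, F (dist x y)) :=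
        Finset.sum_le_sum fun n _ => mul_le_mul_of_nonneg_left
          (hop_pow_indicator_le hF hM h𝒵 hX hc hdiam hyX n) (by positivity)
    _ = (∑ n ∈ Finset.Ico ⌈r / R⌉₊ N, (M * C * t) ^ n / n !) / C * ∑ x ∈ X, F (dist x y) := by
        rw [Finset.sum_div, Finset.sum_mul]
        exact Finset.sum_congr rfl fun n _ => by ring
    _ ≤ expTail (M * C * t) (r / R) / C * ∑ x ∈ X, F (dist x y) := by
        have sum_nonneg : 0 ≤ ∑ x ∈ X, F (dist x y) :=
          Finset.sum_nonneg fun x _ => (hF.dist_pos x y).le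
        gcongr
        exact sum_Ico_le_expTail (by positivity) _ N

end HopDecay

section FiniteRange

variable {Γ : Type*} [MetricSpace Γ] {F : ℝ → ℝ} {X Λ : Finset Γ} {r : ℝ}

/-- A majorant of the weight at `y` of an observable evolved from `X`: the trivial bound `1` in the
inflation `X(r)`, and the propagation bound outside. -/
noncomputable def coneWeight (F : ℝ → ℝ) (X : Finset Γ) (r ε : ℝ) (y : Γ) : ℝ :=
  if y ∈ inflation X r then 1 else ε * ∑ x ∈ X, F (dist x y)

theorem coneWeight_nonneg (hF : IsFFunction Γ F) {ε : ℝ} (hε : 0 ≤ ε) (y : Γ) :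
    0 ≤ coneWeight F X r ε y :=
  ite_nonneg zero_le_one (mul_nonneg hε (Finset.sum_nonneg fun x _ => (hF.dist_pos x y).le))

theorem sum_coneWeight_le (hF : IsFFunction Γ F) (hr : 0 ≤ r) (ε : ℝ) :
    ∑ y ∈ Λ, coneWeight F X r ε y ≤
      (inflation X r).ncard + ε * ∑ x ∈ X, ∑ y ∈ Λ with y ∉ inflation X r, F (dist x y) := by
  simp only [coneWeight]
  rw [Finset.sum_ite, Finset.sum_const, nsmul_eq_mul, mul_one, Finset.sum_comm, Finset.mul_sum,
    ← Set.ncard_coe_finset]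
  gcongr
  · exact hF.inflation_finite X hr
  · exact fun y hy => (Finset.mem_filter.1 hy).2

theorem hasDerivAt_mul_expTail_div (M C : ℝ) {k : ℝ} (hk : 0 ≤ k) (s : ℝ) :
    HasDerivAt (fun s => M * (expTail (M * C * s) (1 + k) / (M * C * C)))
      (M * (expTail (M * C * s) k / C)) s := by
  have h : HasDerivAt (fun s => expTail (M * C * s) (1 + k)) (expTail (M * C * s) k * (M * C)) s :=
    (hasDerivAt_expTail hk (M * C * s)).comp s (hasDerivAt_const_mul (M * C))
  refine ((h.div_const _).const_mul M).congr_deriv ?_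
  rcases eq_or_ne M 0 with rfl | hM
  · simp only [zero_mul]
  rcases eq_or_ne C 0 with rfl | hC
  · simp only [mul_zero, div_zero]
  field_simp

/-- The subsets of `Λ` of diameter at most `R`: the labels of the terms kept in the evolution of
finite range. -/
noncomputable def smallSets (Λ : Finset Γ) (R : ℝ) : Finset (Finset Γ) :=
  Λ.powerset.filter fun W : Finset Γ => Metric.diam (W : Set Γ) ≤ R

theorem mem_smallSets {W : Finset Γ} {R : ℝ} :
    W ∈ smallSets Λ R ↔ W ⊆ Λ ∧ Metric.diam (W : Set Γ) ≤ R := by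
  rw [smallSets, Finset.mem_filter, Finset.mem_powerset]

theorem smallSets_subset_powerset {R : ℝ} : smallSets Λ R ⊆ Λ.powerset :=
  Finset.filter_subset _ _

variable [DecidableEq Γ] {E : Type*} [NormedAddCommGroup E] [NormedSpace ℝ E]
  {D : Finset Γ → E →L[ℝ] E} {c : Finset Γ → ℝ} {𝒮 𝒵 : Finset (Finset Γ)} {M R : ℝ} {T : ℝ → E}

theorem IsLocalFamily.norm_apply_solution_le_coneWeight (h : IsLocalFamily D c)
    (hF : IsFFunction Γ F) (hM : 0 ≤ M) (h𝒮 : ∀ W ∈ 𝒮, W ⊆ Λ) (hX : X ⊆ Λ)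
    (hc : HasFBound F 𝒮 c M) (hdiam : ∀ W ∈ 𝒮, Metric.diam (W : Set Γ) ≤ R) (hr : 0 ≤ r)
    (hR : 0 < R) (hT : ∀ s, HasDerivAt T (∑ W ∈ 𝒮, D W (T s)) s)
    (hT0 : ∀ Z, Disjoint X Z → D Z (T 0) = 0) {t : ℝ} (ht : 0 ≤ t) (Z : Finset Γ) :
    ‖D Z (T t)‖ ≤ c Z * ‖T 0‖ * ∑ y ∈ Z,
      coneWeight F X r (expTail (M * convConst Γ F * t) (r / R) / convConst Γ F) y := by
  set w := coneWeight F X r (expTail (M * convConst Γ F * t) (r / R) / convConst Γ F) with hw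
  by_cases hZ : ∃ y ∈ Z, y ∈ inflation X r
  · obtain ⟨y, hyZ, hy⟩ := hZ
    have hC := convConst_nonneg Γ F
    have w_nonneg (z : Γ) : 0 ≤ w z :=
      coneWeight_nonneg hF (div_nonneg (expTail_nonneg (by positivity) _) hC) z
    have one_le : 1 ≤ ∑ y ∈ Z, w y := calc
      1 = w y := (if_pos hy).symm
      _ ≤ _ := Finset.single_le_sum (fun z _ => w_nonneg z) hyZ
    calc ‖D Z (T t)‖ ≤ c Z * ‖T t‖ := h.norm_le _ _
      _ ≤ c Z * ‖T 0‖ := mul_le_mul_of_nonneg_left (h.norm_solution_le hT ht) (h.nonneg Z)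
      _ ≤ c Z * ‖T 0‖ * ∑ y ∈ Z, w y :=
          le_mul_of_one_le_right (mul_nonneg (h.nonneg Z) (norm_nonneg _)) one_le
  · push Not at hZ
    refine h.norm_apply_solution_le hT (Set.indicator_nonneg fun _ _ => zero_le_one)
      (h.norm_apply_le_indicator hT0) ht fun y hy N => ?_
    rw [hw, coneWeight, if_neg (hZ y hy)]
    exact sum_hop_pow_indicator_le hF hM h𝒮 hX hc hdiam hr hR (hZ y hy) ht N

theorem HasFBound.sum_mul_sum_le (hF : IsFFunction Γ F) (hM : 0 ≤ M) (hR : 0 ≤ R)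
    (hc : HasFBound F 𝒵 c M) (h𝒵 : ∀ W ∈ 𝒵, W ⊆ Λ)
    (hdiam : ∀ W ∈ 𝒵, R < Metric.diam (W : Set Γ)) {w : Γ → ℝ} (hw : 0 ≤ w) :
    ∑ W ∈ 𝒵, c W * ∑ y ∈ W, w y ≤ M * tail Γ F (R / 2) * ∑ y ∈ Λ, w y := by
  rw [sum_mul_sum_eq_sum_mul h𝒵, Finset.mul_sum]
  exact Finset.sum_le_sum fun y _ =>
    mul_le_mul_of_nonneg_right (hc.sum_le_tail hF hM hR hdiam y) (hw y)

theorem IsLocalFamily.sum_norm_apply_solution_le (h : IsLocalFamily D c)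
    (hF : IsFFunction Γ F) (hM : 0 ≤ M) (hX : X ⊆ Λ) (hc : HasFBound F Λ.powerset c M)
    (hr : 0 ≤ r) (hR : 0 < R)
    (hT : ∀ s, HasDerivAt T (∑ W ∈ smallSets Λ R, D W (T s)) s)
    (hT0 : ∀ Z, Disjoint X Z → D Z (T 0) = 0) {t : ℝ} (ht : 0 ≤ t) :
    ∑ W ∈ Λ.powerset \ smallSets Λ R, ‖D W (T t)‖ ≤
      ‖T 0‖ * (M * tail Γ F (R / 2) * ((inflation X r).ncard +
        expTail (M * convConst Γ F * t) (r / R) / convConst Γ F *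
          ∑ x ∈ X, ∑ y ∈ Λ with y ∉ inflation X r, F (dist x y))) := by
  have large (W) (hW : W ∈ Λ.powerset \ smallSets Λ R) : W ⊆ Λ ∧ R < Metric.diam (W : Set Γ) := by
    obtain ⟨hWΛ, hWR⟩ := Finset.mem_sdiff.1 hW
    rw [Finset.mem_powerset] at hWΛ
    exact ⟨hWΛ, not_le.1 fun hdiam => hWR (mem_smallSets.2 ⟨hWΛ, hdiam⟩)⟩
  set ε := expTail (M * convConst Γ F * t) (r / R) / convConst Γ F
  have hG : 0 ≤ tail Γ F (R / 2) := ENNReal.toReal_nonneg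
  have w_nonneg : 0 ≤ coneWeight F X r ε := fun y =>
    have hC := convConst_nonneg Γ F
    coneWeight_nonneg hF (div_nonneg (expTail_nonneg (by positivity) _) hC) y
  calc ∑ W ∈ Λ.powerset \ smallSets Λ R, ‖D W (T t)‖
      ≤ ∑ W ∈ Λ.powerset \ smallSets Λ R,
          ‖T 0‖ * (c W * ∑ y ∈ W, coneWeight F X r ε y) :=
        Finset.sum_le_sum fun W _ => (h.norm_apply_solution_le_coneWeight hF hM
          (fun W hW => (mem_smallSets.1 hW).1) hX (hc.mono smallSets_subset_powerset)
          (fun W hW => (mem_smallSets.1 hW).2) hr hR hT hT0 ht W).trans_eq (by ring)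
    _ ≤ ‖T 0‖ * (M * tail Γ F (R / 2) * ∑ y ∈ Λ, coneWeight F X r ε y) := by
        rw [← Finset.mul_sum]
        refine mul_le_mul_of_nonneg_left ?_ (norm_nonneg _)
        exact (hc.mono Finset.sdiff_subset).sum_mul_sum_le hF hM hR.le
          (fun W hW => (large W hW).1) (fun W hW => (large W hW).2) w_nonneg
    _ ≤ _ := by
        gcongr
        exact sum_coneWeight_le hF hr ε

theorem IsLocalFamily.norm_solution_sub_truncated_le (h : IsLocalFamily D c)
    (hF : IsFFunction Γ F) (hM : 0 ≤ M) (hX : X ⊆ Λ) (hc : HasFBound F Λ.powerset c M)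
    (hr : 0 ≤ r) (hR : 0 < R) {T' : ℝ → E}
    (hT : ∀ s, HasDerivAt T (∑ W ∈ Λ.powerset, D W (T s)) s)
    (hT' : ∀ s, HasDerivAt T' (∑ W ∈ smallSets Λ R, D W (T' s)) s)
    (h0 : T 0 = T' 0) (hT0 : ∀ Z, Disjoint X Z → D Z (T' 0) = 0) {t : ℝ} (ht : 0 ≤ t) :
    ‖T t - T' t‖ ≤ ‖T' 0‖ * M * tail Γ F (R / 2) * (t * (inflation X r).ncard +
      expTail (M * convConst Γ F * t) (1 + r / R) / (M * convConst Γ F * convConst Γ F) *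
        ∑ x ∈ X, ∑ y ∈ Λ with y ∉ inflation X r, F (dist x y)) := by
  set S := ∑ x ∈ X, ∑ y ∈ Λ with y ∉ inflation X r, F (dist x y)
  set C := convConst Γ F
  have hk : 0 ≤ r / R := div_nonneg hr hR.le
  have deriv_bound (s : ℝ) : HasDerivAt (fun s => ‖T' 0‖ * M * tail Γ F (R / 2) *
      (s * (inflation X r).ncard + expTail (M * C * s) (1 + r / R) / (M * C * C) * S))
      (‖T' 0‖ * (M * tail Γ F (R / 2) *
        ((inflation X r).ncard + expTail (M * C * s) (r / R) / C * S))) s := by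
    have hB := ((hasDerivAt_mul_const (x := s) ((inflation X r).ncard : ℝ)).const_mul
      (‖T' 0‖ * M * tail Γ F (R / 2))).add
      ((hasDerivAt_mul_expTail_div M C hk s).const_mul (‖T' 0‖ * tail Γ F (R / 2) * S))
    exact (hB.congr_of_eventuallyEq (.of_forall fun s => by
      simp only [Pi.add_apply]; ring)).congr_deriv (by ring)
  exact h.norm_solution_sub_le smallSets_subset_powerset hT hT' h0 deriv_bound
    (by simp [expTail_zero hk])
    (fun s hs => h.sum_norm_apply_solution_le hF hM hX hc hr hR hT' hT0 hs) ht

end FiniteRange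

section Semigroup

variable {E : Type*} [NormedAddCommGroup E] [NormedSpace ℂ E]

theorem exp_ofReal_zero_smul_apply (D : E →L[ℂ] E) (x : E) :
    NormedSpace.exp (((0 : ℝ) : ℂ) • D) x = x := by
  simp

theorem hasDerivAt_exp_ofReal_smul_apply [CompleteSpace E] (D : E →L[ℂ] E) (x : E) (t : ℝ) :
    HasDerivAt (fun s : ℝ => NormedSpace.exp ((s : ℂ) • D) x)
      (D (NormedSpace.exp ((t : ℂ) • D) x)) t := by
  have h := (hasDerivAt_exp_smul_const' D (t : ℂ)).scomp t Complex.ofRealCLM.hasDerivAt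
  rw [Complex.ofRealCLM_apply, Complex.ofReal_one, one_smul] at h
  exact ((ContinuousLinearMap.apply ℂ E x).restrictScalars ℝ).hasFDerivAt.comp_hasDerivAt t h

variable {Γ : Type*} [DecidableEq Γ] {ι : Γ → Type*} [∀ x, Fintype (ι x)]
  [∀ x, DecidableEq (ι x)] {Λ : Finset Γ}

theorem semigroup_zero_apply (𝓖 : Obs ι Λ →ₗ[ℂ] Obs ι Λ) (A : Obs ι Λ) :
    semigroup 𝓖 0 A = A :=
  exp_ofReal_zero_smul_apply 𝓖.toContinuousLinearMap A

theorem hasDerivAt_semigroup_apply (𝓖 : Obs ι Λ →ₗ[ℂ] Obs ι Λ) (A : Obs ι Λ) (t : ℝ) :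
    HasDerivAt (fun s => semigroup 𝓖 s A) (𝓖 (semigroup 𝓖 t A)) t :=
  hasDerivAt_exp_ofReal_smul_apply 𝓖.toContinuousLinearMap A t

end Semigroup

section Interaction

variable {Γ : Type*} [DecidableEq Γ] {ι : Γ → Type*} [∀ x, Fintype (ι x)]
  {L : ∀ Z : Finset Γ, Obs ι Z →ₗ[ℂ] Obs ι Z} {X Λ Z : Finset Γ}

/-- The interaction term of `Z` acting on the observables of `Λ`, as a real-linear map. Defined
to be `0` if `Z` is not contained in `Λ`, so as to be indexed by all finite sets. -/
noncomputable def localMap (L : ∀ Z : Finset Γ, Obs ι Z →ₗ[ℂ] Obs ι Z) (Λ Z : Finset Γ) :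
    Obs ι Λ →L[ℝ] Obs ι Λ :=
  if h : Z ⊆ Λ then (extend h (L Z)).toContinuousLinearMap.restrictScalars ℝ else 0

theorem localMap_apply_of_subset (h : Z ⊆ Λ) (A : Obs ι Λ) :
    localMap L Λ Z A = extend h (L Z) A := by
  rw [localMap, dif_pos h]
  rfl

theorem localMap_of_not_subset (h : ¬ Z ⊆ Λ) : localMap L Λ Z = 0 :=
  dif_neg h

theorem localMap_empty (hL : ∀ Z, IsLindblad (L Z)) : localMap L Λ ∅ = 0 := by
  ext1 A
  rw [localMap_apply_of_subset (Finset.empty_subset Λ), (hL ∅).eq_zero_of_subsingleton]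
  rfl

theorem generator_apply (A : Obs ι Λ) :
    generator L Λ A = ∑ Z ∈ Λ.powerset, localMap L Λ Z A := by
  rw [generator, LinearMap.sum_apply]
  refine Eq.trans (Finset.sum_congr rfl fun Z _ => ?_)
    (Finset.sum_coe_sort Λ.powerset fun Z => localMap L Λ Z A)
  exact (localMap_apply_of_subset (Finset.mem_powerset.1 Z.2) A).symm

variable [∀ x, DecidableEq (ι x)]

theorem localMap_embed_eq_zero (hL : ∀ Z, IsLindblad (L Z)) (hX : X ⊆ Λ) (hd : Disjoint X Z)
    (A : Obs ι X) : localMap L Λ Z (embed hX A) = 0 := by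
  by_cases h : Z ⊆ Λ
  · rw [localMap_apply_of_subset h]
    exact extend_embed_eq_zero h hX hd (hL Z).map_one A
  · rw [localMap_of_not_subset h, zero_apply]

theorem isLocalFamily_localMap (hL : ∀ Z, IsLindblad (L Z)) (hfin : ∀ Z, cbNorm (L Z) ≠ ∞)
    (Λ : Finset Γ) : IsLocalFamily (localMap L Λ) fun Z => (cbNorm (L Z)).toReal where
  nonneg Z := ENNReal.toReal_nonneg
  norm_le Z A := by
    by_cases h : Z ⊆ Λ
    · rw [localMap_apply_of_subset h]
      exact norm_extend_le h (hfin Z) A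
    · rw [localMap_of_not_subset h, zero_apply, norm_zero]
      exact mul_nonneg ENNReal.toReal_nonneg (norm_nonneg A)
  map_empty := localMap_empty hL
  dissipative Z := by
    by_cases h : Z ⊆ Λ
    · rw [funext (localMap_apply_of_subset h)]
      exact (hL Z).isDissipative_extend h
    · rw [localMap_of_not_subset h]
      exact IsDissipative.zero
  comm Y Z hd A := by
    by_cases hY : Y ⊆ Λ
    · by_cases hZ : Z ⊆ Λ
      · simp only [localMap_apply_of_subset hY, localMap_apply_of_subset hZ]
        exact extend_comm hY hZ hd (L Y) (L Z) A
      · simp only [localMap_of_not_subset hZ, zero_apply, map_zero]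
    · simp only [localMap_of_not_subset hY, zero_apply, map_zero]

end Interaction

section Dynamics

variable {Γ : Type*} [MetricSpace Γ] [DecidableEq Γ] {ι : Γ → Type*} [∀ x, Fintype (ι x)]
  {F : ℝ → ℝ} {L : ∀ Z : Finset Γ, Obs ι Z →ₗ[ℂ] Obs ι Z} {X Λ : Finset Γ}

theorem generatorRange_apply (R : ℝ) (A : Obs ι Λ) :
    generatorRange L Λ R A = ∑ Z ∈ smallSets Λ R, localMap L Λ Z A := by
  rw [generatorRange, LinearMap.sum_apply, smallSets, Finset.sum_filter, Finset.sum_filter]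
  refine Eq.trans (Finset.sum_congr rfl fun Z _ => ?_) (Finset.sum_coe_sort Λ.powerset
    fun Z => if Metric.diam (Z : Set Γ) ≤ R then localMap L Λ Z A else 0)
  rw [localMap_apply_of_subset (Finset.mem_powerset.1 Z.2)]

variable [∀ x, DecidableEq (ι x)]

theorem tsum_cbNorm_le_fNorm (hF : IsFFunction Γ F) (x y : Γ) :
    ∑' Z : {Z : Finset Γ // x ∈ Z ∧ y ∈ Z}, cbNorm (L Z) ≤
      fNorm F L * ENNReal.ofReal (F (dist x y)) := by
  have h0 : ENNReal.ofReal (F (dist x y)) ≠ 0 := (ENNReal.ofReal_pos.2 (hF.dist_pos x y)).ne'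
  rw [← ENNReal.div_le_iff h0 ENNReal.ofReal_ne_top]
  exact le_sInf fun M hM => (ENNReal.div_le_iff h0 ENNReal.ofReal_ne_top).2 (hM x y)

theorem sum_cbNorm_le_fNorm (hF : IsFFunction Γ F) (𝒵 : Finset (Finset Γ)) (x y : Γ) :
    ∑ Z ∈ 𝒵 with x ∈ Z ∧ y ∈ Z, cbNorm (L Z) ≤ fNorm F L * ENNReal.ofReal (F (dist x y)) := by
  rw [← Finset.sum_subtype_eq_sum_filter]
  exact (ENNReal.sum_le_tsum _).trans (tsum_cbNorm_le_fNorm hF x y)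

theorem cbNorm_ne_top (hF : IsFFunction Γ F) (hL : ∀ Z, IsLindblad (L Z)) (hLF : fNorm F L < ∞)
    (Z : Finset Γ) : cbNorm (L Z) ≠ ∞ := by
  rcases Z.eq_empty_or_nonempty with rfl | ⟨x, hx⟩
  · have amplify_zero (n : ℕ) : amplify n (0 : Obs ι ∅ →ₗ[ℂ] Obs ι ∅) = 0 := rfl
    simp [(hL ∅).eq_zero_of_subsingleton, cbNorm, amplify_zero]
  · have h := sum_cbNorm_le_fNorm (L := L) hF {Z} x x
    rw [Finset.filter_singleton, if_pos ⟨hx, hx⟩, Finset.sum_singleton] at h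
    exact (h.trans_lt (ENNReal.mul_lt_top hLF ENNReal.ofReal_lt_top)).ne

theorem hasFBound_cbNorm (hF : IsFFunction Γ F) (hL : ∀ Z, IsLindblad (L Z))
    (hLF : fNorm F L < ∞) (𝒵 : Finset (Finset Γ)) :
    HasFBound F 𝒵 (fun Z => (cbNorm (L Z)).toReal) (fNorm F L).toReal where
  nonneg Z := ENNReal.toReal_nonneg
  sum_le x y := by
    rw [← ENNReal.toReal_sum fun Z _ => cbNorm_ne_top hF hL hLF Z,
      ← ENNReal.toReal_ofReal (hF.dist_pos x y).le, ← ENNReal.toReal_mul]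
    exact ENNReal.toReal_mono (ENNReal.mul_lt_top hLF ENNReal.ofReal_lt_top).ne
      (sum_cbNorm_le_fNorm hF 𝒵 x y)

theorem norm_dynamics_sub_dynamicsRange_le (hF : IsFFunction Γ F) (hL : ∀ Z, IsLindblad (L Z))
    (hLF : fNorm F L < ∞) (hX : X ⊆ Λ) (A : Obs ι X) {t r R : ℝ} (ht : 0 ≤ t) (hr : 0 ≤ r)
    (hR : 0 < R) :
    ‖dynamics L Λ t (embed hX A) - dynamicsRange L Λ R t (embed hX A)‖ ≤
      ‖A‖ * (fNorm F L).toReal * tail Γ F (R / 2) * (t * (inflation X r).ncard +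
        expTail ((fNorm F L).toReal * convConst Γ F * t) (1 + r / R) /
            ((fNorm F L).toReal * convConst Γ F * convConst Γ F) *
          ∑ x ∈ X, ∑ y ∈ Λ with y ∉ inflation X r, F (dist x y)) := by
  have initial : dynamicsRange L Λ R 0 (embed hX A) = embed hX A := semigroup_zero_apply _ _
  have hD := isLocalFamily_localMap hL (cbNorm_ne_top hF hL hLF) Λ
  have hM : 0 ≤ (fNorm F L).toReal := ENNReal.toReal_nonneg
  have hC := convConst_nonneg Γ F
  have hG := tail_nonneg Γ F (R / 2)
  have hE : 0 ≤ expTail ((fNorm F L).toReal * convConst Γ F * t) (1 + r / R) :=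
    expTail_nonneg (by positivity) _
  have hS : 0 ≤ ∑ x ∈ X, ∑ y ∈ Λ with y ∉ inflation X r, F (dist x y) :=
    Finset.sum_nonneg fun x _ => Finset.sum_nonneg fun y _ => (hF.dist_pos x y).le
  have bound := hD.norm_solution_sub_truncated_le hF hM hX (hasFBound_cbNorm hF hL hLF Λ.powerset)
    hr hR
    (fun s => (hasDerivAt_semigroup_apply _ (embed hX A) s).congr_deriv (generator_apply _))
    (fun s => (hasDerivAt_semigroup_apply _ (embed hX A) s).congr_deriv (generatorRange_apply R _))
    ((semigroup_zero_apply _ _).trans (semigroup_zero_apply _ _).symm)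
    (fun Z hd => (congrArg _ initial).trans (localMap_embed_eq_zero hL hX hd A)) ht
  refine (bound.trans_eq (by rw [semigroup_zero_apply])).trans ?_
  gcongr
  exact norm_embed_le hX A

end Dynamics

end OpenSpin

theorem theorem2p4 {Γ : Type*} [MetricSpace Γ] [Countable Γ] [DecidableEq Γ]
    (ι : Γ → Type*) [∀ x, Fintype (ι x)] [∀ x, DecidableEq (ι x)]
    (F : ℝ → ℝ) (hF : OpenSpin.IsFFunction Γ F)
    (L : ∀ Z : Finset Γ, OpenSpin.Obs ι Z →ₗ[ℂ] OpenSpin.Obs ι Z)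
    (hL : ∀ Z, OpenSpin.IsLindblad (L Z)) (hLF : OpenSpin.fNorm F L < ∞)
    (X Λ : Finset Γ) (hX : X ⊆ Λ) (A : OpenSpin.Obs ι X)
    (t r R v C : ℝ) (ht : 0 ≤ t) (hr : 0 ≤ r) (hR : 0 < R)
    (hC : C = OpenSpin.convConst Γ F) (hv : v = (OpenSpin.fNorm F L).toReal * C) :
    (OpenSpin.inflation X r).Finite ∧
    ‖OpenSpin.dynamics L Λ t (OpenSpin.embed hX A) -
        OpenSpin.dynamicsRange L Λ R t (OpenSpin.embed hX A)‖ ≤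
      ‖A‖ * (OpenSpin.fNorm F L).toReal * OpenSpin.tail Γ F (R / 2) *
        (t * (OpenSpin.inflation X r).ncard +
          OpenSpin.expTail (v * t) (1 + r / R) / (v * C) *
            ∑ x ∈ X, ∑ y ∈ Λ with y ∉ OpenSpin.inflation X r, F (dist x y)) := by
  subst hC hv
  exact ⟨hF.inflation_finite X hr,
    OpenSpin.norm_dynamics_sub_dynamicsRange_le hF hL hLF hX A ht hr hR⟩
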